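/- Let $n\ge 1$, let $c>0$, and let $v_0:\mathbb R^n\to\mathbb R^n$ be a $C^2$ vector field with bounded $C^2$ norm such that $$\inf_{\alpha\in\mathbb R^n}\det\left(\frac{\partial v_0}{\partial\alpha}(\alpha)\right)<0 .$$ Then there is $\varepsilon_0>0$, depending only on $n$, $c$ and $v_0$, such that the following holds for every $\varepsilon\in(0,\varepsilon_0]$ and every scale factor $a:[0,\infty)\to(0,\infty)$ that satisfies Assumption $H_3$: $a$ is twice differentiable, $a(0)=1$, $\dot a(t)>0$ and $\ddot a(t)<0$ for all $t\ge0$, and for some $0<l\le\frac12$ the function $a(t)$ is comparable to $(1+t)^l$ as $t\to\infty$ (that is, $C^{-1}(1+t)^l\le a(t)\le C(1+t)^l$ for some constant $C>0$ and all large $t$). Consider the Cauchy problem for the relativistic Burgers equation $$\frac{\partial v^i}{\partial t}+\sum_{j=1}^{n}\frac{v^j}{a(t)}\frac{\partial v^i}{\partial x^j}+\frac{\dot a(t)}{a(t)}v^i-\frac{\dot a(t)}{a(t)}\frac{|v|^2}{c^2}v^i=0\quad(i=1,\dots,n),\qquad v(0,x)=\varepsilon v_0(x).$$ Then $|\nabla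 v|$ blows up in finite time. Precisely: there are a finite $T>0$ and a classical solution $v\in C^1([0,T)\times\mathbb R^n)$ that is unique and maximal (every classical solution $w\in C^1([0,T')\times\mathbb R^n)$ has $T'\le T$ and coincides with $v$ on $[0,T')$), and $$\sup_{x\in\mathbb R^n}|\nabla v(t,x)|\to\infty\quad\text{as }t\uparrow T .$$ Moreover there is a first blow-up time $T_1\in(0,T]$ of the supremum of the gradient: $\nabla v$ is bounded on $[0,t]\times\mathbb R^n$ for every $t<T_1$, and $\sup_{x}|\nabla v(t,x)|\to\infty$ as $t\uparrow T_1$. (Suprema take values in $[0,\infty]$.) -/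

import Mathlib

open Set Filter Topology

noncomputable section

/-- The decelerated, slowly expanding scale factors on `[0, ∞)`: `a` is positive and twice
differentiable, `a 0 = 1`, `ȧ > 0`, `ä < 0`, and `a(t)` is comparable to `(1 + t) ^ l` for large
`t`, where `0 < l ≤ 1 / 2`. Derivatives are taken within `[0, ∞)`, so they are one-sided at
`t = 0`. -/
structure IsSlowScaleFactor (a : ℝ → ℝ) (l : ℝ) : Prop where
  pos : ∀ t ∈ Ici (0 : ℝ), 0 < a t
  init : a 0 = 1
  diff : DifferentiableOn ℝ a (Ici 0)
  diff_deriv : DifferentiableOn ℝ (derivWithin a (Ici 0)) (Ici 0)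
  deriv_pos : ∀ t ∈ Ici (0 : ℝ), 0 < derivWithin a (Ici 0) t
  deriv2_neg : ∀ t ∈ Ici (0 : ℝ), derivWithin (derivWithin a (Ici 0)) (Ici 0) t < 0
  exponent_pos : 0 < l
  exponent_le : l ≤ 1 / 2
  growth : a =Θ[atTop] fun t : ℝ => (1 + t) ^ l

/-- `w` is a `C²` vector field on `ℝⁿ` with finite `C²` norm: `w` and its derivatives of order
one and two are bounded. -/
structure IsBoundedC2 {n : ℕ} (w : EuclideanSpace ℝ (Fin n) → EuclideanSpace ℝ (Fin n)) :
    Prop where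
  contDiff : ContDiff ℝ 2 w
  bounded : ∀ k : ℕ, k ≤ 2 → ∃ C : ℝ, ∀ x, ‖iteratedFDeriv ℝ k w x‖ ≤ C

/-- `v` is a classical solution on `[0, T) × ℝⁿ` of the relativistic Burgers equation
`∂ₜ v + (1 / a) (v · ∇) v + (ȧ / a) v - (ȧ / a) (|v|² / c²) v = 0` with initial value `w₀`:
it is `C¹` on `[0, T) × ℝⁿ`, up to `t = 0`, and satisfies the equation there.
The values `v t` with `t ∉ [0, T)` play no role. -/
structure IsClassicalSolution {n : ℕ} (c : ℝ) (a : ℝ → ℝ)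
    (w₀ : EuclideanSpace ℝ (Fin n) → EuclideanSpace ℝ (Fin n)) (T : ℝ)
    (v : ℝ → EuclideanSpace ℝ (Fin n) → EuclideanSpace ℝ (Fin n)) : Prop where
  contDiffOn : ContDiffOn ℝ 1
    (fun p : ℝ × EuclideanSpace ℝ (Fin n) => v p.1 p.2) (Ico 0 T ×ˢ univ)
  equation : ∀ t ∈ Ico 0 T, ∀ x,
    derivWithin (fun s => v s x) (Ici 0) t
      + (1 / a t) • fderiv ℝ (v t) x (v t x)
      + (derivWithin a (Ici 0) t / a t) • v t x
      - (derivWithin a (Ici 0) t / a t * (‖v t x‖ ^ 2 / c ^ 2)) • v t x = 0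
  initial : 0 < T → v 0 = w₀

/-- `sup_x |∇v(t, x)|`, as an extended nonnegative real number. -/
def gradSup {n : ℕ} (v : ℝ → EuclideanSpace ℝ (Fin n) → EuclideanSpace ℝ (Fin n)) (t : ℝ) :
    ENNReal :=
  ⨆ x, ‖fderiv ℝ (v t) x‖ₑ

end

/-! Along a characteristic `ẋ = v/a` the equation becomes `v̇ = -(ȧ/a)(1 - |v|²/c²)v`. In terms of
the relativistic momentum `p = v/√(1 - |v|²/c²)` this says that `a p` is constant. The flow is
therefore explicit: with initial momentum `m(α)`, the velocity is `V = velocityOf c (m(α)/a)` and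
the position is `X = α + ∫ a⁻¹ V`.

Differentiating in the label gives `DX = id + D ∘ Dm` with `D = ∫ a⁻² D(velocityOf)(m/a)`. Since
`velocityOf` and `momentumOf` are tangent to the identity at `0`, small data give `D ≈ Λ id` with `Λ
= ∫ a⁻²`, and `Dm ≈ ε Dv₀`. At a label where `det Dv₀ < 0`, `DX` is thus `εΛ` times a small
perturbation of `Dv₀` once `εΛ` is large. The bound `l ≤ 1/2` makes `Λ` diverge, so `det DX` passes
from `1` to a negative value and vanishes on the way (`exists_singular_of_small`). Momenta only
decrease because `a ≥ 1`, so the smallness needed does not depend on `a`.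

Let `T` be the infimum of the times at which `DX` is singular at some label. Before `T` the flow is
a bijective local diffeomorphism (`injective_of_deformation`, `surjective_of_bounded_displacement`),
and `v = V ∘ X⁻¹` is a `C¹` solution. A Grönwall estimate along each explicit characteristic gives
uniqueness (`IsClassicalSolution.eq_along_characteristic`).

Blow-up rests on `|e| ≤ |DX e| + κ |DV e|` (`exists_norm_le_fderiv_position_add`) together with `DV
= ∇v ∘ DX`: where `DX e` is small, `DV e` is not, so `∇v` is large. The same inequality rules out a
solution that lives past `T`. Labels form a noncompact set, so degeneration is measured by the
infimum `leastStretch`; its first zero is `T₁`, which may precede `T`. -/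

/-! ### Scale factors and the divergence of `∫ a⁻²`. -/

/-- A positive `C¹` function on the line with value `1` at `0` which is at least `1` on `[0, ∞)`. -/
structure IsRegularScale (A : ℝ → ℝ) : Prop where
  contDiff : ContDiff ℝ 1 A
  pos : ∀ t, 0 < A t
  init : A 0 = 1
  one_le : ∀ t, 0 ≤ t → 1 ≤ A t

lemma IsRegularScale.continuous {A : ℝ → ℝ} (hA : IsRegularScale A) : Continuous A :=
  hA.contDiff.continuous

lemma IsRegularScale.ne_zero {A : ℝ → ℝ} (hA : IsRegularScale A) (t : ℝ) : A t ≠ 0 :=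
  (hA.pos t).ne'

/-- The part of a scale factor on `[0, ∞)` extends to a regular scale on the line. -/
lemma IsSlowScaleFactor.exists_isRegularScale {a : ℝ → ℝ} {l : ℝ} (ha : IsSlowScaleFactor a l) :
    ∃ A : ℝ → ℝ, IsRegularScale A ∧ (∀ t, 0 ≤ t → A t = a t) ∧
      ∀ t, 0 ≤ t → HasDerivAt A (derivWithin a (Ici 0) t) t := by
  set b := derivWithin a (Ici 0) with hb
  have hbc : ContinuousOn b (Ici 0) := ha.diff_deriv.continuousOn
  have hac : ContinuousOn a (Ici 0) := ha.diff.continuousOn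
  -- The logarithmic derivative `ȧ/a` is frozen at its value at `0` for negative times; the
  -- exponential of its primitive is then `C¹` on the whole line, which removes one-sided
  -- derivatives from the study of the flow.
  set h : ℝ → ℝ := fun s => b (max s 0) / a (max s 0) with hh
  have hmax : Continuous fun s : ℝ => max s 0 := by fun_prop
  have hmem : ∀ s : ℝ, max s 0 ∈ Ici (0 : ℝ) := fun s => Set.mem_Ici.2 (le_max_right _ _)
  have hhc : Continuous h :=
    (hbc.comp_continuous hmax hmem).div (hac.comp_continuous hmax hmem)
      fun s => (ha.pos _ (hmem s)).ne'
  have hhpos : ∀ s, 0 ≤ h s := fun s =>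
    div_nonneg (ha.deriv_pos _ (hmem s)).le (ha.pos _ (hmem s)).le
  set H : ℝ → ℝ := fun t => ∫ s in (0 : ℝ)..t, h s with hH
  have hHd : ∀ t, HasDerivAt H (h t) t := fun t => hhc.integral_hasStrictDerivAt 0 t |>.hasDerivAt
  have hAd : ∀ t, HasDerivAt (fun t => Real.exp (H t)) (Real.exp (H t) * h t) t :=
    fun t => (hHd t).exp
  have hHc : Continuous H := continuous_iff_continuousAt.2 fun t => (hHd t).continuousAt
  have hH0 : H 0 = 0 := by simp [hH]
  have hEq : ∀ t, 0 ≤ t → Real.exp (H t) = a t := by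
    intro t ht
    -- `a` and `exp H` have the same logarithmic derivative on `[0, ∞)`, so their quotient is
    -- constant.
    have key : ∀ x ∈ Icc (0 : ℝ) t, a x * Real.exp (-H x) = a 0 * Real.exp (-H 0) := by
      apply constant_of_has_deriv_right_zero
      · exact (hac.mono Icc_subset_Ici_self).mul (by fun_prop)
      · intro x hx
        have h1 : HasDerivWithinAt a (b x) (Ici x) x :=
          ((ha.diff x hx.1).hasDerivWithinAt).mono (Ici_subset_Ici.2 hx.1)
        have h2 : HasDerivWithinAt (fun t => Real.exp (-H t)) (Real.exp (-H x) * (-h x)) (Ici x) x :=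
          ((hHd x).neg.exp).hasDerivWithinAt
        refine (h1.mul h2).congr_deriv ?_
        have hp : a x ≠ 0 := (ha.pos x hx.1).ne'
        simp only [hh, max_eq_left hx.1]
        field_simp
        ring
    have := key t ⟨ht, le_rfl⟩
    rw [ha.init, hH0, neg_zero, Real.exp_zero, one_mul, Real.exp_neg] at this
    field_simp at this
    exact this.symm
  refine ⟨fun t => Real.exp (H t), ⟨?_, fun t => Real.exp_pos _, by simp [hH0], ?_⟩, hEq, ?_⟩
  · rw [contDiff_one_iff_deriv]
    refine ⟨fun t => (hAd t).differentiableAt, ?_⟩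
    rw [funext fun t => (hAd t).deriv]
    fun_prop
  · intro t ht
    exact Real.one_le_exp (intervalIntegral.integral_nonneg ht fun s _ => hhpos s)
  · intro t ht
    refine (hAd t).congr_deriv ?_
    rw [hEq t ht]
    simp only [hh, max_eq_left ht]
    field_simp [(ha.pos t ht).ne']

/-- The integral of `1 / a²` diverges for a slow scale factor. -/
lemma IsSlowScaleFactor.tendsto_integral {a A : ℝ → ℝ} {l : ℝ} (ha : IsSlowScaleFactor a l)
    (hA : IsRegularScale A) (hEq : ∀ t, 0 ≤ t → A t = a t) :
    Tendsto (fun t => ∫ s in (0 : ℝ)..t, ((A s) ^ 2)⁻¹) atTop atTop := by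
  have hcont : Continuous fun s => ((A s) ^ 2)⁻¹ :=
    (hA.continuous.pow 2).inv₀ fun s => pow_ne_zero _ (hA.ne_zero s)
  obtain ⟨C, hCpos, hC⟩ := ha.growth.1.exists_pos
  obtain ⟨t₀, ht₀⟩ := eventually_atTop.1 (hC.bound)
  set t₁ := max t₀ 0 with ht₁
  have ht₁0 : 0 ≤ t₁ := le_max_right _ _
  -- This is where `l ≤ 1/2` enters: `A⁻²` dominates a multiple of `1/(1 + t)`, whose integral is
  -- logarithmic.
  have hle : ∀ t, t₁ ≤ t → (A t) ^ 2 ≤ C ^ 2 * (1 + t) := by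
    intro t ht
    have ht0 : 0 ≤ t := ht₁0.trans ht
    have h1 := ht₀ t ((le_max_left _ _).trans ht)
    have h2 : ‖(1 + t) ^ l‖ ≤ (1 + t) ^ (1 / 2 : ℝ) := by
      rw [Real.norm_of_nonneg (by positivity)]
      exact Real.rpow_le_rpow_of_exponent_le (by linarith) ha.exponent_le
    rw [Real.norm_of_nonneg (ha.pos t ht0).le] at h1
    rw [hEq t ht0]
    have h3 : a t ≤ C * √(1 + t) := by
      rw [Real.sqrt_eq_rpow]
      exact h1.trans (mul_le_mul_of_nonneg_left h2 hCpos.le)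
    calc a t ^ 2 ≤ (C * √(1 + t)) ^ 2 := pow_le_pow_left₀ (ha.pos t ht0).le h3 2
      _ = C ^ 2 * (1 + t) := by rw [mul_pow, Real.sq_sqrt (by linarith)]
  have hint : ∀ u v, IntervalIntegrable (fun s => ((A s) ^ 2)⁻¹) MeasureTheory.volume u v :=
    fun u v => hcont.intervalIntegrable u v
  have hlog : ∀ t, t₁ ≤ t → (C ^ 2)⁻¹ * (Real.log (1 + t) - Real.log (1 + t₁)) ≤
      ∫ s in (0 : ℝ)..t, ((A s) ^ 2)⁻¹ := by
    intro t ht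
    have hd : ∀ s ∈ uIcc t₁ t, HasDerivAt (fun s => (C ^ 2)⁻¹ * Real.log (1 + s))
        ((C ^ 2)⁻¹ * (1 + s)⁻¹) s := by
      intro s hs
      rw [uIcc_of_le ht] at hs
      have : (1 : ℝ) + s ≠ 0 := by linarith [hs.1]
      have := ((hasDerivAt_id s).const_add 1).log this
      simpa using this.const_mul ((C ^ 2)⁻¹)
    have hi : IntervalIntegrable (fun s : ℝ => (C ^ 2)⁻¹ * (1 + s)⁻¹) MeasureTheory.volume t₁ t := by
      apply ContinuousOn.intervalIntegrable
      rw [uIcc_of_le ht]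
      refine continuousOn_const.mul (ContinuousOn.inv₀ (by fun_prop) fun s hs => ?_)
      linarith [hs.1]
    have h1 := intervalIntegral.integral_eq_sub_of_hasDerivAt hd hi
    have h2 : ∫ s in t₁..t, (C ^ 2)⁻¹ * (1 + s)⁻¹ ≤ ∫ s in t₁..t, ((A s) ^ 2)⁻¹ := by
      refine intervalIntegral.integral_mono_on ht hi (hint _ _) fun s hs => ?_
      rw [← mul_inv]
      exact inv_anti₀ (pow_pos (hA.pos s) 2) (hle s hs.1)
    have h3 : 0 ≤ ∫ s in (0 : ℝ)..t₁, ((A s) ^ 2)⁻¹ :=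
      intervalIntegral.integral_nonneg ht₁0 fun s _ => by positivity
    rw [← intervalIntegral.integral_add_adjacent_intervals (hint 0 t₁) (hint t₁ t)]
    rw [h1] at h2
    linarith
  refine tendsto_atTop_mono' atTop (eventually_atTop.2 ⟨t₁, hlog⟩) ?_
  refine Tendsto.const_mul_atTop (by positivity) ?_
  refine tendsto_atTop_add_const_right _ _ ?_
  exact Real.tendsto_log_atTop.comp (tendsto_atTop_add_const_left _ _ tendsto_id)

/-! ### Relativistic velocity and momentum. -/

noncomputable section Velocity

lemma one_add_sq_div_pos {E : Type*} [NormedAddCommGroup E] (c : ℝ) (p : E) : 0 < 1 + ‖p‖ ^ 2 / c ^ 2 := by positivity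

lemma one_sub_sq_div_pos {E : Type*} [NormedAddCommGroup E] {c : ℝ} (hc : 0 < c) {w : E} (hw : ‖w‖ < c) :
    0 < 1 - ‖w‖ ^ 2 / c ^ 2 := by
  have : ‖w‖ ^ 2 < c ^ 2 := pow_lt_pow_left₀ hw (norm_nonneg _) two_ne_zero
  rw [sub_pos, div_lt_one (by positivity)]
  exact this

variable {E : Type*} [NormedAddCommGroup E] [InnerProductSpace ℝ E]

/-- The velocity of a relativistic particle of unit mass with momentum `p`. -/
def velocityOf (c : ℝ) (p : E) : E := (√(1 + ‖p‖ ^ 2 / c ^ 2))⁻¹ • p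

/-- The momentum of a relativistic particle of unit mass with velocity `w`. -/
def momentumOf (c : ℝ) (w : E) : E := (√(1 - ‖w‖ ^ 2 / c ^ 2))⁻¹ • w

lemma contDiff_velocityOf (c : ℝ) {k : WithTop ℕ∞} :
    ContDiff ℝ k (velocityOf c : E → E) := by
  have h : ContDiff ℝ k fun p : E => 1 + ‖p‖ ^ 2 / c ^ 2 :=
    contDiff_const.add ((contDiff_norm_sq ℝ).div_const _)
  refine ContDiff.smul (ContDiff.inv (h.sqrt fun p => (one_add_sq_div_pos c p).ne') fun p => ?_)
    contDiff_id
  exact (Real.sqrt_pos.2 (one_add_sq_div_pos c p)).ne'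

lemma contDiffAt_momentumOf {c : ℝ} (hc : 0 < c) {k : WithTop ℕ∞} {w : E} (hw : ‖w‖ < c) :
    ContDiffAt ℝ k (momentumOf c : E → E) w := by
  have h : ContDiff ℝ k fun p : E => 1 - ‖p‖ ^ 2 / c ^ 2 :=
    contDiff_const.sub ((contDiff_norm_sq ℝ).div_const _)
  have hp := one_sub_sq_div_pos hc hw
  exact ((h.contDiffAt.sqrt hp.ne').inv (Real.sqrt_pos.2 hp).ne').smul contDiffAt_id

lemma norm_velocityOf_sq (c : ℝ) (p : E) :
    ‖velocityOf c p‖ ^ 2 = ‖p‖ ^ 2 / (1 + ‖p‖ ^ 2 / c ^ 2) := by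
  rw [velocityOf, norm_smul, mul_pow, norm_inv, inv_pow, Real.norm_eq_abs, sq_abs,
    Real.sq_sqrt (one_add_sq_div_pos c p).le]
  field_simp

/-- The Lorentz factor expressed through velocity and through momentum. It yields the speed limit,
the inversion of `velocityOf`, and the factor `1 - |v|²/c²` in the equation of motion. -/
lemma one_sub_norm_velocityOf_sq {c : ℝ} (hc : 0 < c) (p : E) :
    1 - ‖velocityOf c p‖ ^ 2 / c ^ 2 = (1 + ‖p‖ ^ 2 / c ^ 2)⁻¹ := by
  rw [norm_velocityOf_sq]
  have := one_add_sq_div_pos c p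
  have h2 : c ^ 2 + ‖p‖ ^ 2 ≠ 0 := by positivity
  field_simp
  ring

lemma norm_velocityOf_lt {c : ℝ} (hc : 0 < c) (p : E) : ‖velocityOf c p‖ < c := by
  have h := one_sub_norm_velocityOf_sq hc p
  have h2 : 0 < 1 - ‖velocityOf c p‖ ^ 2 / c ^ 2 := by
    rw [h]; exact inv_pos.2 (one_add_sq_div_pos c p)
  rw [sub_pos, div_lt_one (by positivity)] at h2
  exact lt_of_pow_lt_pow_left₀ 2 hc.le h2

lemma momentumOf_velocityOf {c : ℝ} (hc : 0 < c) (p : E) :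
    momentumOf c (velocityOf c p) = p := by
  rw [momentumOf, one_sub_norm_velocityOf_sq hc, Real.sqrt_inv, inv_inv, velocityOf, smul_smul,
    mul_inv_cancel₀ (Real.sqrt_pos.2 (one_add_sq_div_pos c p)).ne', one_smul]

lemma velocityOf_momentumOf {c : ℝ} (hc : 0 < c) {w : E} (hw : ‖w‖ < c) :
    velocityOf c (momentumOf c w) = w := by
  have hp := one_sub_sq_div_pos hc hw
  have h : 1 + ‖momentumOf c w‖ ^ 2 / c ^ 2 = (1 - ‖w‖ ^ 2 / c ^ 2)⁻¹ := by
    rw [momentumOf, norm_smul, mul_pow, norm_inv, inv_pow, Real.norm_eq_abs, sq_abs,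
      Real.sq_sqrt hp.le]
    have : c ^ 2 - ‖w‖ ^ 2 ≠ 0 := by
      intro h0
      apply hp.ne'
      field_simp
      linarith
    field_simp
    ring
  rw [velocityOf, h, Real.sqrt_inv, inv_inv, momentumOf, smul_smul,
    mul_inv_cancel₀ (Real.sqrt_pos.2 hp).ne', one_smul]

/-- In the product rule the derivative of `f` is multiplied by the base point `0`. Hence
`velocityOf` and `momentumOf` are both tangent to the identity at `0`. -/
lemma hasFDerivAt_smul_self_zero {f : E → ℝ} (hf : DifferentiableAt ℝ f 0) (h1 : f 0 = 1) :
    HasFDerivAt (fun p => f p • p) (ContinuousLinearMap.id ℝ E) 0 := by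
  refine (hf.hasFDerivAt.smul (hasFDerivAt_id 0)).congr_fderiv ?_
  ext e
  simp [h1]

lemma fderiv_velocityOf_zero (c : ℝ) :
    fderiv ℝ (velocityOf c) (0 : E) = ContinuousLinearMap.id ℝ E := by
  refine (hasFDerivAt_smul_self_zero (f := fun p : E => (√(1 + ‖p‖ ^ 2 / c ^ 2))⁻¹) ?_
    (by simp)).fderiv
  have h : ContDiff ℝ 1 fun p : E => 1 + ‖p‖ ^ 2 / c ^ 2 :=
    contDiff_const.add ((contDiff_norm_sq ℝ).div_const _)
  exact ((h.contDiffAt.sqrt (by simp)).inv (by simp)).differentiableAt one_ne_zero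

lemma fderiv_momentumOf_zero (c : ℝ) :
    fderiv ℝ (momentumOf c) (0 : E) = ContinuousLinearMap.id ℝ E := by
  refine (hasFDerivAt_smul_self_zero (f := fun p : E => (√(1 - ‖p‖ ^ 2 / c ^ 2))⁻¹) ?_
    (by simp)).fderiv
  have h : ContDiff ℝ 1 fun p : E => 1 - ‖p‖ ^ 2 / c ^ 2 :=
    contDiff_const.sub ((contDiff_norm_sq ℝ).div_const _)
  exact ((h.contDiffAt.sqrt (by simp)).inv (by simp)).differentiableAt one_ne_zero

lemma continuous_fderiv_velocityOf (c : ℝ) : Continuous (fderiv ℝ (velocityOf c : E → E)) :=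
  (contDiff_velocityOf (k := 1) c).continuous_fderiv one_ne_zero

lemma continuousAt_fderiv_momentumOf {c : ℝ} (hc : 0 < c) {w : E} (hw : ‖w‖ < c) :
    ContinuousAt (fderiv ℝ (momentumOf c : E → E)) w :=
  (contDiffAt_momentumOf (k := 1) hc hw).continuousAt_fderiv one_ne_zero

/-- The derivative of the momentum–velocity map is bounded below on bounded sets. -/
lemma exists_norm_le_fderiv_velocityOf [FiniteDimensional ℝ E] {c : ℝ} (hc : 0 < c) (R : ℝ) :
    ∃ C : ℝ, 0 < C ∧ ∀ p : E, ‖p‖ ≤ R → ∀ e, ‖e‖ ≤ C * ‖fderiv ℝ (velocityOf c) p e‖ := by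
  have hcont : Continuous fun p : E => fderiv ℝ (momentumOf c) (velocityOf c p) := by
    rw [continuous_iff_continuousAt]
    intro p
    exact ContinuousAt.comp (continuousAt_fderiv_momentumOf hc (norm_velocityOf_lt hc p))
      (contDiff_velocityOf (k := 1) c).continuous.continuousAt
  obtain ⟨C, hC⟩ := (isCompact_closedBall (0 : E) R).exists_bound_of_continuousOn hcont.continuousOn
  refine ⟨max C 1, by positivity, fun p hp e => ?_⟩
  have hid : (fderiv ℝ (momentumOf c) (velocityOf c p)).comp (fderiv ℝ (velocityOf c) p) =
      ContinuousLinearMap.id ℝ E := by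
    rw [← fderiv_comp p
      ((contDiffAt_momentumOf (k := 1) hc (norm_velocityOf_lt hc p)).differentiableAt one_ne_zero)
      ((contDiff_velocityOf (k := 1) c).differentiable one_ne_zero p)]
    have : momentumOf c ∘ velocityOf c = (id : E → E) := funext (momentumOf_velocityOf hc)
    rw [this, fderiv_id]
  calc ‖e‖ = ‖fderiv ℝ (momentumOf c) (velocityOf c p) (fderiv ℝ (velocityOf c) p e)‖ := by
        rw [← ContinuousLinearMap.comp_apply, hid]; rfl
    _ ≤ ‖fderiv ℝ (momentumOf c) (velocityOf c p)‖ * ‖fderiv ℝ (velocityOf c) p e‖ :=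
        ContinuousLinearMap.le_opNorm _ _
    _ ≤ max C 1 * ‖fderiv ℝ (velocityOf c) p e‖ := by
        gcongr
        exact (hC p (by simpa using hp)).trans (le_max_left _ _)

/-- Free fall in an expanding universe: the momentum decays like `1 / A`. -/
lemma hasDerivAt_velocityOf_inv_smul {c : ℝ} (hc : 0 < c) {A : ℝ → ℝ} {A' t : ℝ}
    (hA : HasDerivAt A A' t) (hpos : ∀ s, 0 < A s) (p : E) :
    HasDerivAt (fun s => velocityOf c ((A s)⁻¹ • p))
      (-((A' / A t) • velocityOf c ((A t)⁻¹ • p) - (A' / A t *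
        (‖velocityOf c ((A t)⁻¹ • p)‖ ^ 2 / c ^ 2)) • velocityOf c ((A t)⁻¹ • p))) t := by
  -- Clearing `A` from the square root leaves a scalar function of `A s` times the fixed vector `p`.
  have hform : ∀ s, velocityOf c ((A s)⁻¹ • p) = (√(A s ^ 2 + ‖p‖ ^ 2 / c ^ 2))⁻¹ • p := by
    intro s
    have hs := hpos s
    have h1 : A s ^ 2 + ‖p‖ ^ 2 / c ^ 2 = A s ^ 2 * (1 + ‖(A s)⁻¹ • p‖ ^ 2 / c ^ 2) := by
      rw [norm_smul, norm_inv, Real.norm_of_nonneg hs.le]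
      field_simp
    rw [velocityOf, smul_smul, h1, Real.sqrt_mul (by positivity), Real.sqrt_sq hs.le, mul_inv,
      mul_comm]
  have hS : 0 < A t ^ 2 + ‖p‖ ^ 2 / c ^ 2 := by have := hpos t; positivity
  have h1 := one_sub_norm_velocityOf_sq hc ((A t)⁻¹ • p)
  have h2 : (1 + ‖(A t)⁻¹ • p‖ ^ 2 / c ^ 2)⁻¹ = A t ^ 2 / (A t ^ 2 + ‖p‖ ^ 2 / c ^ 2) := by
    have := hpos t
    rw [norm_smul, norm_inv, Real.norm_of_nonneg this.le]
    field_simp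
  have h3 : HasDerivAt (fun s => A s ^ 2 + ‖p‖ ^ 2 / c ^ 2) (2 * A t * A') t := by
    simpa using (hA.pow 2).add_const (‖p‖ ^ 2 / c ^ 2)
  have h4 := ((h3.sqrt hS.ne').inv (Real.sqrt_pos.2 hS).ne').smul_const p
  rw [funext hform]
  refine h4.congr_deriv ?_
  rw [← sub_smul, ← neg_smul]
  rw [show A' / A t - A' / A t * (‖velocityOf c ((A t)⁻¹ • p)‖ ^ 2 / c ^ 2) =
    A' / A t * (A t ^ 2 / (A t ^ 2 + ‖p‖ ^ 2 / c ^ 2)) by rw [← h2, ← h1]; ring]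
  rw [hform t, smul_smul]
  congr 1
  have := (hpos t).ne'
  rw [Real.sq_sqrt hS.le]
  have hs := (Real.sqrt_pos.2 hS).ne'
  generalize √(A t ^ 2 + ‖p‖ ^ 2 / c ^ 2) = r at *
  generalize A t ^ 2 + ‖p‖ ^ 2 / c ^ 2 = S at *
  field_simp

end Velocity

/-! ### Displacement of free particles and its derivative in the momentum. -/

noncomputable section Displacement

section ParametricIntegral

variable {E F : Type*} [NormedAddCommGroup E] [NormedSpace ℝ E] [FiniteDimensional ℝ E]
  [NormedAddCommGroup F] [NormedSpace ℝ F]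

/-- Differentiation under the integral sign: continuity of `f'` bounds it on the compact set of
times in the interval and parameters in a unit ball, and the constant bound is integrable. -/
lemma hasFDerivAt_intervalIntegral_of_continuous {f : ℝ → E → F} {f' : ℝ → E → E →L[ℝ] F}
    (hf : Continuous (Function.uncurry f)) (hf' : Continuous (Function.uncurry f'))
    (hd : ∀ s p, HasFDerivAt (f s) (f' s p) p) (t : ℝ) (p : E) :
    HasFDerivAt (fun p => ∫ s in (0 : ℝ)..t, f s p) (∫ s in (0 : ℝ)..t, f' s p) p := by
  obtain ⟨C, hC⟩ := (isCompact_uIcc.prod (isCompact_closedBall p 1)).exists_bound_of_continuousOn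
    (s := uIcc (0 : ℝ) t ×ˢ Metric.closedBall p 1) hf'.continuousOn
  have hfs : ∀ q, Continuous fun s => f s q := fun q => hf.comp (by fun_prop : Continuous fun s => (s, q))
  have hfs' : Continuous fun s => f' s p := hf'.comp (by fun_prop : Continuous fun s => (s, p))
  refine intervalIntegral.hasFDerivAt_integral_of_dominated_of_fderiv_le (F := fun q s => f s q)
    (F' := fun q s => f' s q) (bound := fun _ => C)
    (Metric.closedBall_mem_nhds p one_pos) (Eventually.of_forall fun q => (hfs q).aestronglyMeasurable)
    ((hfs p).intervalIntegrable _ _) hfs'.aestronglyMeasurable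
    (Eventually.of_forall fun s hs q hq => hC (s, q) ⟨uIoc_subset_uIcc hs, hq⟩)
    intervalIntegrable_const (Eventually.of_forall fun s _ q _ => hd s q)

/-- The time partial is the integrand and the space partial is the integral of `f'`. Both are
jointly continuous, which gives joint `C¹` regularity without any differentiability of `f` in time.
-/
lemma contDiff_intervalIntegral_of_continuous [CompleteSpace F] {f : ℝ → E → F}
    {f' : ℝ → E → E →L[ℝ] F}
    (hf : Continuous (Function.uncurry f)) (hf' : Continuous (Function.uncurry f'))
    (hd : ∀ s p, HasFDerivAt (f s) (f' s p) p) :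
    ContDiff ℝ 1 (fun x : ℝ × E => ∫ s in (0 : ℝ)..x.1, f s x.2) := by
  have hfs : ∀ q, Continuous fun s => f s q :=
    fun q => hf.comp (by fun_prop : Continuous fun s => (s, q))
  set I : ℝ → E → F := fun t p => ∫ s in (0 : ℝ)..t, f s p
  set I₁ : ℝ → E → ℝ →L[ℝ] F := fun t p => ContinuousLinearMap.toSpanSingleton ℝ (f t p)
  set I₂ : ℝ → E → E →L[ℝ] F := fun t p => ∫ s in (0 : ℝ)..t, f' s p
  have c1 : Continuous (fun x : ℝ × E => I₁ x.1 x.2) :=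
    (ContinuousLinearMap.toSpanSingletonCLE (𝕜 := ℝ) (E := F)).continuous.comp hf
  have c2 : Continuous (fun x : ℝ × E => I₂ x.1 x.2) := by
    refine intervalIntegral.continuous_parametric_intervalIntegral_of_continuous
      (f := fun (x : ℝ × E) s => f' s x.2) ?_ continuous_fst
    exact hf'.comp (by fun_prop : Continuous fun y : (ℝ × E) × ℝ => (y.2, y.1.2))
  have key : ∀ x : ℝ × E, HasStrictFDerivAt (fun x : ℝ × E => I x.1 x.2)
      ((I₁ x.1 x.2).coprod (I₂ x.1 x.2)) x := by
    intro x
    refine hasStrictFDerivAt_uncurry_coprod (f := I) (f₁ := I₁) (f₂ := I₂)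
      (Eventually.of_forall fun y => ?_) (Eventually.of_forall fun y => ?_)
      c1.continuousAt c2.continuousAt
    · exact ((hfs y.2).integral_hasStrictDerivAt 0 y.1).hasDerivAt.hasFDerivAt
    · exact hasFDerivAt_intervalIntegral_of_continuous hf hf' hd y.1 y.2
  rw [contDiff_one_iff_hasFDerivAt]
  refine ⟨_, ?_, fun x => (key x).hasFDerivAt⟩
  have : Continuous fun x : ℝ × E => (I₁ x.1 x.2).comp (ContinuousLinearMap.fst ℝ ℝ E) +
      (I₂ x.1 x.2).comp (ContinuousLinearMap.snd ℝ ℝ E) := by fun_prop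
  exact this.congr fun x => ContinuousLinearMap.ext fun v => by simp

end ParametricIntegral

variable {E : Type*} [NormedAddCommGroup E] [InnerProductSpace ℝ E]

/-- Comoving displacement up to time `t` of a free particle with initial momentum `p`. -/
def displacement (c : ℝ) (A : ℝ → ℝ) (t : ℝ) (p : E) : E :=
  ∫ s in (0 : ℝ)..t, (A s)⁻¹ • velocityOf c ((A s)⁻¹ • p)

/-- The derivative of the displacement with respect to the initial momentum. -/
def displacementDeriv (c : ℝ) (A : ℝ → ℝ) (t : ℝ) (p : E) : E →L[ℝ] E :=
  ∫ s in (0 : ℝ)..t, ((A s) ^ 2)⁻¹ • fderiv ℝ (velocityOf c) ((A s)⁻¹ • p)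

variable {c : ℝ} {A : ℝ → ℝ}

lemma IsRegularScale.continuous_inv (hA : IsRegularScale A) : Continuous fun s => (A s)⁻¹ :=
  hA.continuous.inv₀ hA.ne_zero

lemma IsRegularScale.continuous_sq_inv (hA : IsRegularScale A) :
    Continuous fun s => ((A s) ^ 2)⁻¹ :=
  (hA.continuous.pow 2).inv₀ fun s => pow_ne_zero _ (hA.ne_zero s)

lemma IsRegularScale.continuous_integrand (hA : IsRegularScale A) (c : ℝ) :
    Continuous (Function.uncurry fun (s : ℝ) (p : E) => (A s)⁻¹ • velocityOf c ((A s)⁻¹ • p)) := by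
  have h1 := hA.continuous_inv
  have h2 := (contDiff_velocityOf (E := E) (k := 1) c).continuous
  exact (h1.comp continuous_fst).smul (h2.comp ((h1.comp continuous_fst).smul continuous_snd))

lemma IsRegularScale.continuous_integrand_deriv (hA : IsRegularScale A) (c : ℝ) :
    Continuous (Function.uncurry fun (s : ℝ) (p : E) =>
      ((A s) ^ 2)⁻¹ • fderiv ℝ (velocityOf c) ((A s)⁻¹ • p)) := by
  have h1 := hA.continuous_inv
  have h2 := hA.continuous_sq_inv
  have h3 := continuous_fderiv_velocityOf (E := E) c
  exact (h2.comp continuous_fst).smul (h3.comp ((h1.comp continuous_fst).smul continuous_snd))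

lemma hasFDerivAt_velocityOf_smul (c b : ℝ) (p : E) :
    HasFDerivAt (fun p : E => velocityOf c (b • p)) (b • fderiv ℝ (velocityOf c) (b • p)) p := by
  have h1 := ((contDiff_velocityOf (E := E) (k := 1) c).differentiable one_ne_zero
    (b • p)).hasFDerivAt
  refine (h1.comp p ((hasFDerivAt_id p).const_smul b)).congr_fderiv ?_
  ext e
  simp

lemma hasFDerivAt_integrand (s : ℝ) (p : E) :
    HasFDerivAt (fun p : E => (A s)⁻¹ • velocityOf c ((A s)⁻¹ • p))
      (((A s) ^ 2)⁻¹ • fderiv ℝ (velocityOf c) ((A s)⁻¹ • p)) p := by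
  refine ((hasFDerivAt_velocityOf_smul c _ p).const_smul ((A s)⁻¹)).congr_fderiv ?_
  rw [smul_smul, sq, mul_inv]

lemma hasFDerivAt_displacement [FiniteDimensional ℝ E] (hA : IsRegularScale A) (t : ℝ) (p : E) :
    HasFDerivAt (displacement c A t) (displacementDeriv c A t p) p :=
  hasFDerivAt_intervalIntegral_of_continuous (hA.continuous_integrand c)
    (hA.continuous_integrand_deriv c) (fun s p => hasFDerivAt_integrand s p) t p

lemma contDiff_displacement [FiniteDimensional ℝ E] (hA : IsRegularScale A) :
    ContDiff ℝ 1 fun x : ℝ × E => displacement c A x.1 x.2 :=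
  have : CompleteSpace E := FiniteDimensional.complete ℝ E
  contDiff_intervalIntegral_of_continuous (hA.continuous_integrand c)
    (hA.continuous_integrand_deriv c) (fun s p => hasFDerivAt_integrand s p)

lemma hasDerivAt_displacement [CompleteSpace E] (hA : IsRegularScale A) (t : ℝ) (p : E) :
    HasDerivAt (fun t => displacement c A t p) ((A t)⁻¹ • velocityOf c ((A t)⁻¹ • p)) t :=
  (((hA.continuous_integrand c).comp (by fun_prop : Continuous fun s : ℝ => (s, p))
    ).integral_hasStrictDerivAt 0 t).hasDerivAt

lemma displacement_zero (p : E) : displacement c A 0 p = 0 := by simp [displacement]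

/-- Speeds stay below `c` and `A ≥ 1`. Uniformity in `p` is what gives properness of the flow and
compactness of the set of possible collisions. -/
lemma norm_displacement_le (hc : 0 < c) (hA : IsRegularScale A) {t : ℝ} (ht : 0 ≤ t) (p : E) :
    ‖displacement c A t p‖ ≤ c * t := by
  have := intervalIntegral.norm_integral_le_of_norm_le_const (a := 0) (b := t) (C := c)
    (f := fun s => (A s)⁻¹ • velocityOf c ((A s)⁻¹ • p)) fun s hs => ?_
  · simpa [displacement, abs_of_nonneg ht] using this
  · rw [uIoc_of_le ht] at hs
    rw [norm_smul, norm_inv, Real.norm_of_nonneg (hA.pos s).le]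
    calc (A s)⁻¹ * ‖velocityOf c ((A s)⁻¹ • p)‖ ≤ 1 * c := by
          gcongr
          · exact inv_le_one_of_one_le₀ (hA.one_le s hs.1.le)
          · exact (norm_velocityOf_lt hc _).le
      _ = c := one_mul c

lemma IsRegularScale.norm_inv_smul_le (hA : IsRegularScale A) {s : ℝ} (hs : 0 ≤ s) (p : E) :
    ‖(A s)⁻¹ • p‖ ≤ ‖p‖ := by
  rw [norm_smul, norm_inv, Real.norm_of_nonneg (hA.pos s).le]
  exact mul_le_of_le_one_left (norm_nonneg _) (inv_le_one_of_one_le₀ (hA.one_le s hs))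

lemma intervalIntegrable_displacementDeriv (hA : IsRegularScale A) (p : E) (s t : ℝ) :
    IntervalIntegrable (fun s => ((A s) ^ 2)⁻¹ • fderiv ℝ (velocityOf c) ((A s)⁻¹ • p))
      MeasureTheory.volume s t :=
  ((hA.continuous_integrand_deriv c).comp
    (by fun_prop : Continuous fun s : ℝ => (s, p))).intervalIntegrable s t

/-- The displacement derivative is Lipschitz in time, uniformly for bounded momenta. -/
lemma exists_norm_displacementDeriv_sub_le [FiniteDimensional ℝ E] (hA : IsRegularScale A)
    (c R : ℝ) :
    ∃ M : ℝ, 0 ≤ M ∧ ∀ p : E, ‖p‖ ≤ R → ∀ s t, 0 ≤ s → 0 ≤ t →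
      ‖displacementDeriv c A t p - displacementDeriv c A s p‖ ≤ M * |t - s| := by
  obtain ⟨M, hM⟩ := (isCompact_closedBall (0 : E) R).exists_bound_of_continuousOn
    (continuous_fderiv_velocityOf (E := E) c).continuousOn
  refine ⟨max M 0, le_max_right _ _, fun p hp s t hs ht => ?_⟩
  rw [displacementDeriv, displacementDeriv, intervalIntegral.integral_interval_sub_left
    (intervalIntegrable_displacementDeriv hA p _ _) (intervalIntegrable_displacementDeriv hA p _ _)]
  refine intervalIntegral.norm_integral_le_of_norm_le_const fun r hr => ?_
  have hr0 : 0 ≤ r := (le_min hs ht).trans hr.1.le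
  rw [norm_smul, norm_inv, Real.norm_of_nonneg (by positivity)]
  have h1 : ((A r) ^ 2)⁻¹ ≤ 1 := inv_le_one_of_one_le₀ (one_le_pow₀ (hA.one_le r hr0))
  have h2 := hM ((A r)⁻¹ • p) (by simpa using (hA.norm_inv_smul_le hr0 p).trans hp)
  calc ((A r) ^ 2)⁻¹ * ‖fderiv ℝ (velocityOf c) ((A r)⁻¹ • p)‖ ≤ 1 * M := by gcongr
    _ ≤ max M 0 := by rw [one_mul]; exact le_max_left _ _

lemma displacementDeriv_zero (p : E) : displacementDeriv c A 0 p = 0 := by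
  simp [displacementDeriv]

/-- For small momenta the displacement is nearly proportional to the momentum. -/
lemma norm_displacementDeriv_sub_le [FiniteDimensional ℝ E] (hA : IsRegularScale A) {ρ η : ℝ}
    (h : ∀ q : E, ‖q‖ ≤ ρ →
      ‖fderiv ℝ (velocityOf c) q - ContinuousLinearMap.id ℝ E‖ ≤ η)
    {p : E} (hp : ‖p‖ ≤ ρ) {t : ℝ} (ht : 0 ≤ t) :
    ‖displacementDeriv c A t p -
        (∫ s in (0 : ℝ)..t, ((A s) ^ 2)⁻¹) • ContinuousLinearMap.id ℝ E‖ ≤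
      η * ∫ s in (0 : ℝ)..t, ((A s) ^ 2)⁻¹ := by
  have hi := hA.continuous_sq_inv
  have : CompleteSpace E := FiniteDimensional.complete ℝ E
  have hsm : (∫ s in (0 : ℝ)..t, ((A s) ^ 2)⁻¹) • ContinuousLinearMap.id ℝ E =
      ∫ s in (0 : ℝ)..t, ((A s) ^ 2)⁻¹ • ContinuousLinearMap.id ℝ E :=
    by
    rw [intervalIntegral.integral_smul_const (𝕜 := ℝ) (fun s => ((A s) ^ 2)⁻¹)]
  have hi' : Continuous fun s => ((A s) ^ 2)⁻¹ • ContinuousLinearMap.id ℝ E :=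
    hi.smul continuous_const
  rw [displacementDeriv, hsm, ← intervalIntegral.integral_sub
    (intervalIntegrable_displacementDeriv hA p _ _) (hi'.intervalIntegrable _ _),
    ← intervalIntegral.integral_const_mul]
  refine intervalIntegral.norm_integral_le_of_norm_le ht
    (MeasureTheory.ae_of_all _ fun s hs => ?_) ((hi.const_mul η).intervalIntegrable _ _)
  rw [← smul_sub, norm_smul, norm_inv, Real.norm_of_nonneg (by positivity), mul_comm]
  gcongr
  exact h _ ((hA.norm_inv_smul_le hs.1.le p).trans hp)

end Displacement

/-! ### Global inversion of the flow. -/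

section GlobalInverse

variable {E : Type*} [NormedAddCommGroup E] [NormedSpace ℝ E] [FiniteDimensional ℝ E]
  {X : ℝ → E → E}

omit [FiniteDimensional ℝ E] in
lemma hasFDerivAt_slice {F : Type*} [NormedAddCommGroup F] [NormedSpace ℝ F] {V : ℝ → E → F}
    (hV : ContDiff ℝ 1 fun x : ℝ × E => V x.1 x.2) (t : ℝ) (α : E) :
    HasFDerivAt (V t) ((fderiv ℝ (fun x : ℝ × E => V x.1 x.2) (t, α)).comp
      (ContinuousLinearMap.inr ℝ ℝ E)) α :=
  (hV.differentiable one_ne_zero (t, α)).hasFDerivAt.comp α (hasFDerivAt_prodMk_right t α)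

/-- A time-dependent `C¹` map is locally invertible, jointly in time and space, wherever its
spatial derivative is injective. -/
lemma exists_local_spatial_inverse (hX : ContDiff ℝ 1 fun x : ℝ × E => X x.1 x.2) {t : ℝ} {α : E}
    (hinj : ∀ e, fderiv ℝ (X t) α e = 0 → e = 0) :
    ∃ Y : ℝ × E → E, ContDiffAt ℝ 1 Y (t, X t α) ∧ Y (t, X t α) = α ∧
      (∀ᶠ y in 𝓝 (t, X t α), X y.1 (Y y) = y.2) ∧
      ∀ᶠ x in 𝓝 (t, α), Y (x.1, X x.1 x.2) = x.2 := by
  have : CompleteSpace E := FiniteDimensional.complete ℝ E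
  set G : ℝ × E → E := fun x => X x.1 x.2
  -- Carrying time along as a coordinate makes the inverse function theorem produce an inverse that
  -- is `C¹` jointly in time and space.
  set Φ : ℝ × E → ℝ × E := fun x => (x.1, G x)
  have hΦ : ContDiff ℝ 1 Φ := contDiff_fst.prodMk hX
  set D : ℝ × E →L[ℝ] ℝ × E := (ContinuousLinearMap.fst ℝ ℝ E).prod (fderiv ℝ G (t, α))
  have hD : HasFDerivAt Φ D (t, α) :=
    hasFDerivAt_fst.prodMk (hX.differentiable one_ne_zero (t, α)).hasFDerivAt
  have hDinj : Function.Injective (D : ℝ × E →ₗ[ℝ] ℝ × E) := by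
    rw [← LinearMap.ker_eq_bot, LinearMap.ker_eq_bot']
    rintro ⟨τ, e⟩ h
    have h1 : τ = 0 := congrArg Prod.fst h
    have h2 : fderiv ℝ G (t, α) (τ, e) = 0 := congrArg Prod.snd h
    subst h1
    have h3 : fderiv ℝ (X t) α e = 0 := by
      rw [(hasFDerivAt_slice hX t α).fderiv]
      simpa using h2
    rw [hinj e h3]
    rfl
  let D' : (ℝ × E) ≃L[ℝ] ℝ × E :=
    (LinearEquiv.ofInjectiveEndo (D : ℝ × E →ₗ[ℝ] ℝ × E) hDinj).toContinuousLinearEquiv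
  have hD' : HasFDerivAt Φ (D' : ℝ × E →L[ℝ] ℝ × E) (t, α) := by
    refine hD.congr_fderiv ?_
    ext x <;> rfl
  have hs : HasStrictFDerivAt Φ (D' : ℝ × E →L[ℝ] ℝ × E) (t, α) :=
    hΦ.contDiffAt.hasStrictFDerivAt' hD' one_ne_zero
  set Ψ := hs.localInverse Φ D' (t, α)
  have hΨ : ContDiffAt ℝ 1 Ψ (Φ (t, α)) :=
    hΦ.contDiffAt.to_localInverse hD' one_ne_zero
  refine ⟨fun y => (Ψ y).2, contDiffAt_snd.comp _ hΨ, ?_, ?_, ?_⟩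
  · exact congrArg Prod.snd hs.localInverse_apply_image
  · filter_upwards [hs.eventually_right_inverse] with y hy
    have h1 : (Φ (Ψ y)).1 = y.1 := congrArg Prod.fst hy
    have h2 : (Φ (Ψ y)).2 = y.2 := congrArg Prod.snd hy
    change (Ψ y).1 = y.1 at h1
    change X (Ψ y).1 (Ψ y).2 = y.2 at h2
    rwa [h1] at h2
  · filter_upwards [hs.eventually_left_inverse] with x hx
    exact congrArg Prod.snd hx

/-- A `C¹` map with injective derivative at bounded distance from the identity is onto. -/
lemma surjective_of_bounded_displacement (hX : ContDiff ℝ 1 fun x : ℝ × E => X x.1 x.2) {t C : ℝ}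
    (hb : ∀ α, ‖X t α - α‖ ≤ C) (hinj : ∀ α e, fderiv ℝ (X t) α e = 0 → e = 0) :
    Function.Surjective (X t) := by
  have : ProperSpace E := FiniteDimensional.proper ℝ E
  have hcont : Continuous (X t) := hX.continuous.comp (by fun_prop : Continuous fun α : E => (t, α))
  have hopen : IsOpen (range (X t)) := by
    rw [isOpen_iff_mem_nhds]
    rintro _ ⟨α, rfl⟩
    obtain ⟨Y, -, -, hY, -⟩ := exists_local_spatial_inverse hX (hinj α)
    have hc : Tendsto (fun y : E => (t, y)) (𝓝 (X t α)) (𝓝 (t, X t α)) :=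
      (by fun_prop : Continuous fun y : E => (t, y)).continuousAt
    filter_upwards [hc.eventually hY] with y hy using ⟨_, hy⟩
  have hclosed : IsClosed (range (X t)) := by
    -- Properness follows from `|X t α| ≥ |α| - C`.
    refine (isProperMap_iff_tendsto_cocompact.2 ⟨hcont, ?_⟩).isClosedMap.isClosed_range
    rw [← Metric.cobounded_eq_cocompact, ← comap_norm_atTop, tendsto_comap_iff]
    refine tendsto_atTop_mono (f := fun α : E => ‖α‖ + -C) (fun α => ?_)
      (tendsto_atTop_add_const_right _ _ tendsto_comap)
    have h1 : ‖α‖ ≤ ‖X t α‖ + ‖X t α - α‖ := by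
      calc ‖α‖ = ‖X t α - (X t α - α)‖ := by rw [sub_sub_cancel]
        _ ≤ _ := norm_sub_le _ _
    have h2 := hb α
    simp only [Function.comp_apply]
    linarith
  exact range_eq_univ.1 (IsClopen.eq_univ ⟨hclosed, hopen⟩ (range_nonempty _))

/-- A deformation of the identity through local diffeomorphisms at bounded distance from the
identity stays injective. -/
lemma injective_of_deformation (hX : ContDiff ℝ 1 fun x : ℝ × E => X x.1 x.2)
    (hX0 : ∀ α, X 0 α = α) {t L : ℝ} (ht : 0 ≤ t) (hb : ∀ s, 0 ≤ s → ∀ α, ‖X s α - α‖ ≤ L * s)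
    (hL : 0 ≤ L) (hinj : ∀ s ∈ Icc 0 t, ∀ α e, fderiv ℝ (X s) α e = 0 → e = 0) :
    Function.Injective (X t) := by
  have : ProperSpace E := FiniteDimensional.proper ℝ E
  intro β α hβα
  by_contra hne
  set S : Set (ℝ × E) := {x | X x.1 x.2 = X x.1 α}
  set B : Set (ℝ × E) := Icc 0 t ×ˢ Metric.closedBall α (2 * (L * t))
  -- The collisions with the trajectory of `α`. The proof takes the earliest one and produces an
  -- earlier one still.
  set K : Set (ℝ × E) := (B ∩ S) ∩ {x | x.2 ≠ α}
  have hXα : Continuous fun x : ℝ × E => X x.1 α :=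
    hX.continuous.comp (by fun_prop : Continuous fun x : ℝ × E => (x.1, α))
  have hS : IsClosed S := isClosed_eq hX.continuous hXα
  have hBc : IsCompact B := isCompact_Icc.prod (isCompact_closedBall _ _)
  have hball : ∀ s ∈ Icc 0 t, ∀ γ, X s γ = X s α → γ ∈ Metric.closedBall α (2 * (L * t)) := by
    intro s hs γ h
    have h1 := hb s hs.1 γ
    have h2 := hb s hs.1 α
    have h3 : L * s ≤ L * t := mul_le_mul_of_nonneg_left hs.2 hL
    rw [mem_closedBall_iff_norm]
    calc ‖γ - α‖ = ‖(X s α - α) - (X s γ - γ)‖ := by rw [h]; congr 1; abel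
      _ ≤ ‖X s α - α‖ + ‖X s γ - γ‖ := norm_sub_le _ _
      _ ≤ 2 * (L * t) := by linarith
  -- The condition `γ ≠ α` is open, yet survives limits: the local left inverse `Y` near `(p.1, α)`
  -- forbids collisions with labels close to `α`.
  have hKclosed : IsClosed K := by
    refine isClosed_of_closure_subset fun p hp => ?_
    have hpBS : p ∈ B ∩ S :=
      closure_minimal inter_subset_left (hBc.isClosed.inter hS) hp
    refine ⟨hpBS, fun hpα : p.2 = α => ?_⟩
    obtain ⟨Y, -, -, -, hY⟩ := exists_local_spatial_inverse hX (hinj p.1 hpBS.1.1 α)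
    have hpe : p = (p.1, α) := Prod.ext rfl hpα
    have hc : Tendsto (fun x : ℝ × E => (x.1, α)) (𝓝 p) (𝓝 (p.1, α)) :=
      (by fun_prop : Continuous fun x : ℝ × E => (x.1, α)).continuousAt
    have h1 := hc.eventually hY
    rw [← hpe] at hY
    obtain ⟨q, hqK, hq1, hq2⟩ := ((mem_closure_iff_frequently.1 hp).and_eventually
      (h1.and hY)).exists
    apply hqK.2
    have h3 : X q.1 q.2 = X q.1 α := hqK.1.2
    rw [← hq2, h3]
    exact hq1
  have hKc : IsCompact K :=
    hBc.of_isClosed_subset hKclosed (inter_subset_left.trans inter_subset_left)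
  have htt : t ∈ Icc 0 t := ⟨ht, le_rfl⟩
  have hKne : K.Nonempty := ⟨(t, β), ⟨⟨htt, hball t htt β hβα⟩, hβα⟩, hne⟩
  obtain ⟨⟨s, γ⟩, ⟨⟨⟨hsI, -⟩, hSs⟩, hγ⟩, hmin⟩ := hKc.exists_isMinOn hKne continuous_fst.continuousOn
  have hsI : s ∈ Icc 0 t := hsI
  have hSs : X s γ = X s α := hSs
  have hγ : γ ≠ α := hγ
  have hs0 : 0 < s := by
    refine lt_of_le_of_ne hsI.1 fun h => hγ ?_
    rw [← h, hX0, hX0] at hSs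
    exact hSs
  -- The local inverse at `(s, γ)`, followed along the trajectory of `α` to times `r < s`, gives
  -- labels near `γ`, hence distinct from `α`, that collide with `α` before `s`.
  obtain ⟨Y, hYc, hYγ, hY, -⟩ := exists_local_spatial_inverse hX (hinj s hsI γ)
  rw [hSs] at hYc hY hYγ
  have hc : Tendsto (fun r : ℝ => (r, X r α)) (𝓝 s) (𝓝 (s, X s α)) :=
    (continuous_id.prodMk (hX.continuous.comp
      (by fun_prop : Continuous fun r : ℝ => (r, α)))).continuousAt
  have h1 := hc.eventually hY
  have h2 : ∀ᶠ r in 𝓝 s, Y (r, X r α) ≠ α :=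
    (hYc.continuousAt.tendsto.comp hc).eventually (by
      rw [hYγ]; exact isOpen_ne.mem_nhds hγ)
  have h3 : ∀ᶠ r in 𝓝[<] s, r ∈ Ioo 0 s := Ioo_mem_nhdsLT hs0
  obtain ⟨r, hr3, hr1, hr2⟩ := (h3.and ((h1.and h2).filter_mono nhdsWithin_le_nhds)).exists
  have hrI : r ∈ Icc 0 t := ⟨hr3.1.le, hr3.2.le.trans hsI.2⟩
  have hmem : (r, Y (r, X r α)) ∈ K := ⟨⟨⟨hrI, hball r hrI _ hr1⟩, hr1⟩, hr2⟩
  have := hmin hmem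
  exact absurd hr3.2 (not_lt.2 this)

/-- Along such a deformation, Lagrangian data descend to a `C¹` Eulerian field. -/
lemma exists_eulerian_field (hX : ContDiff ℝ 1 fun x : ℝ × E => X x.1 x.2)
    {F : Type*} [NormedAddCommGroup F] [NormedSpace ℝ F] {V : ℝ → E → F}
    (hV : ContDiff ℝ 1 fun x : ℝ × E => V x.1 x.2) {T : ℝ}
    (hbij : ∀ t ∈ Ico 0 T, Function.Bijective (X t))
    (hinj : ∀ t ∈ Ico 0 T, ∀ α e, fderiv ℝ (X t) α e = 0 → e = 0) :
    ∃ v : ℝ → E → F, ContDiffOn ℝ 1 (fun x : ℝ × E => v x.1 x.2) (Ico 0 T ×ˢ univ) ∧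
      ∀ t ∈ Ico 0 T, ∀ α, v t (X t α) = V t α := by
  set v : ℝ → E → F := fun t x => V t (Function.invFun (X t) x)
  have hv : ∀ t ∈ Ico 0 T, ∀ α, v t (X t α) = V t α := fun t ht α =>
    congrArg (V t) (Function.leftInverse_invFun (hbij t ht).1 α)
  refine ⟨v, ?_, hv⟩
  rintro ⟨t, x⟩ ⟨ht, -⟩
  obtain ⟨α, rfl⟩ := (hbij t ht).2 x
  obtain ⟨Y, hYc, -, hY, -⟩ := exists_local_spatial_inverse hX (hinj t ht α)
  have hc : ContDiffAt ℝ 1 (fun y : ℝ × E => V y.1 (Y y)) (t, X t α) :=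
    hV.contDiffAt.comp _ (contDiffAt_fst.prodMk hYc)
  refine hc.contDiffWithinAt.congr_of_eventuallyEq_of_mem ?_ ⟨ht, mem_univ _⟩
  filter_upwards [self_mem_nhdsWithin, nhdsWithin_le_nhds hY] with y hy1 hy2
  have h := hv y.1 hy1.1 (Y y)
  rw [hy2] at h
  exact h

end GlobalInverse

/-! ### Calculus for `C¹` fields on `[0, T) × E`. -/

section Strip

variable {E F : Type*} [NormedAddCommGroup E] [NormedSpace ℝ E] [NormedAddCommGroup F]
  [NormedSpace ℝ F] {u : ℝ → E → F} {T : ℝ}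

lemma uniqueDiffOn_strip (T : ℝ) : UniqueDiffOn ℝ (Ico 0 T ×ˢ (univ : Set E)) :=
  (uniqueDiffOn_Ico 0 T).prod uniqueDiffOn_univ

lemma hasFDerivAt_slice_of_strip
    (hu : ContDiffOn ℝ 1 (fun x : ℝ × E => u x.1 x.2) (Ico 0 T ×ˢ univ)) {t : ℝ}
    (ht : t ∈ Ico 0 T) (x : E) :
    HasFDerivAt (u t) ((fderivWithin ℝ (fun x : ℝ × E => u x.1 x.2) (Ico 0 T ×ˢ univ) (t, x)).comp
      (ContinuousLinearMap.inr ℝ ℝ E)) x := by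
  have h := (hu.differentiableOn one_ne_zero (t, x) ⟨ht, mem_univ _⟩).hasFDerivWithinAt
  rw [← hasFDerivWithinAt_univ]
  exact h.comp (t := Ico 0 T ×ˢ univ) x (hasFDerivAt_prodMk_right t x).hasFDerivWithinAt
    fun y _ => ⟨ht, mem_univ _⟩

lemma Ico_mem_nhdsWithin_Ici_zero {t : ℝ} (ht : t ∈ Ico 0 T) : Ico 0 T ∈ 𝓝[Ici 0] t := by
  rw [← Ici_inter_Iio]
  exact inter_mem_nhdsWithin _ (Iio_mem_nhds ht.2)

/-- Material derivative along a curve of a `C¹` field on a strip. -/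
lemma hasDerivWithinAt_along_curve
    (hu : ContDiffOn ℝ 1 (fun x : ℝ × E => u x.1 x.2) (Ico 0 T ×ˢ univ)) {t : ℝ}
    (ht : t ∈ Ico 0 T) {y : ℝ → E} {y' : E} (hy : HasDerivAt y y' t) :
    HasDerivWithinAt (fun s => u s (y s))
      (derivWithin (fun s => u s (y t)) (Ici 0) t + fderiv ℝ (u t) (y t) y') (Ici 0) t := by
  set L := fderivWithin ℝ (fun x : ℝ × E => u x.1 x.2) (Ico 0 T ×ˢ univ) (t, y t) with hL
  have h := (hu.differentiableOn one_ne_zero (t, y t) ⟨ht, mem_univ _⟩).hasFDerivWithinAt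
  have hcurve : ∀ (γ : ℝ → E) (γ' : E), γ t = y t → HasDerivAt γ γ' t →
      HasDerivWithinAt (fun s => u s (γ s)) (L (1, γ')) (Ici 0) t := by
    intro γ γ' hγ hd
    rw [← hγ] at h hL
    have h1 : HasDerivWithinAt (fun s => (s, γ s)) (1, γ') (Ico 0 T) t :=
      ((hasDerivAt_id t).prodMk hd).hasDerivWithinAt
    have h2 := h.comp_hasDerivWithinAt t h1
      fun s hs => (⟨hs, mem_univ _⟩ : (s, γ s) ∈ Ico 0 T ×ˢ (univ : Set E))
    rw [← hL] at h2
    exact h2.mono_of_mem_nhdsWithin (Ico_mem_nhdsWithin_Ici_zero ht)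
  -- The constant curve identifies `L (1, 0)` with the partial time derivative.
  have h0 := hcurve (fun _ => y t) 0 rfl (hasDerivAt_const t _)
  rw [h0.derivWithin (uniqueDiffOn_Ici 0 t ht.1), (hasFDerivAt_slice_of_strip hu ht (y t)).fderiv]
  refine (hcurve y y' rfl hy).congr_deriv ?_
  rw [← hL, ContinuousLinearMap.comp_apply, ← map_add]
  simp

lemma continuousOn_fderiv_along_curve
    (hu : ContDiffOn ℝ 1 (fun x : ℝ × E => u x.1 x.2) (Ico 0 T ×ˢ univ)) {y : ℝ → E}
    (hy : ContinuousOn y (Ici 0)) :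
    ContinuousOn (fun t => fderiv ℝ (u t) (y t)) (Ico 0 T) := by
  have h1 := hu.continuousOn_fderivWithin (uniqueDiffOn_strip T) le_rfl
  have h2 : ContinuousOn (fun t => fderivWithin ℝ (fun x : ℝ × E => u x.1 x.2) (Ico 0 T ×ˢ univ)
      (t, y t)) (Ico 0 T) :=
    h1.comp (continuousOn_id.prodMk (hy.mono fun _ hs => hs.1)) fun s hs => ⟨hs, mem_univ _⟩
  exact (h2.clm_comp continuousOn_const).congr fun t ht =>
    (hasFDerivAt_slice_of_strip hu ht (y t)).fderiv

lemma continuousOn_along_curve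
    (hu : ContDiffOn ℝ 1 (fun x : ℝ × E => u x.1 x.2) (Ico 0 T ×ˢ univ)) {y : ℝ → E}
    (hy : ContinuousOn y (Ici 0)) :
    ContinuousOn (fun t => u t (y t)) (Ico 0 T) :=
  hu.continuousOn.comp (continuousOn_id.prodMk (hy.mono fun _ hs => hs.1))
    fun _ hs => ⟨hs, mem_univ _⟩

end Strip

/-! ### The equation along characteristics. -/

section Characteristics

/-- Local Lipschitz bound for the cubic term. It lets the Grönwall argument treat competing
solutions with no a priori bound on their speed. -/
lemma norm_sq_smul_sub_le {E : Type*} [NormedAddCommGroup E] [NormedSpace ℝ E] (p q : E) :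
    ‖‖p‖ ^ 2 • p - ‖q‖ ^ 2 • q‖ ≤ (‖p‖ ^ 2 + (‖p‖ + ‖q‖) * ‖q‖) * ‖p - q‖ := by
  have h : ‖p‖ ^ 2 • p - ‖q‖ ^ 2 • q = ‖p‖ ^ 2 • (p - q) + (‖p‖ ^ 2 - ‖q‖ ^ 2) • q := by
    module
  rw [h]
  refine (norm_add_le _ _).trans ?_
  rw [norm_smul, norm_smul, norm_pow, norm_norm, Real.norm_eq_abs]
  have h1 : |‖p‖ ^ 2 - ‖q‖ ^ 2| ≤ (‖p‖ + ‖q‖) * ‖p - q‖ := by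
    rw [sq_sub_sq, abs_mul, abs_of_nonneg (by positivity : 0 ≤ ‖p‖ + ‖q‖)]
    gcongr
    exact abs_norm_sub_norm_le p q
  nlinarith [mul_le_mul_of_nonneg_right h1 (norm_nonneg q)]

variable {n : ℕ} {c T : ℝ} {a : ℝ → ℝ} {w₀ : EuclideanSpace ℝ (Fin n) → EuclideanSpace ℝ (Fin n)}
  {w : ℝ → EuclideanSpace ℝ (Fin n) → EuclideanSpace ℝ (Fin n)}
  {y V : ℝ → EuclideanSpace ℝ (Fin n)}

/-- A classical solution is determined along every characteristic. -/
lemma IsClassicalSolution.eq_along_characteristic (hw : IsClassicalSolution c a w₀ T w)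
    (ha : ContinuousOn a (Ici 0)) (ha0 : ∀ t, 0 ≤ t → a t ≠ 0)
    (ha' : ContinuousOn (derivWithin a (Ici 0)) (Ici 0))
    (hy : ∀ t, 0 ≤ t → HasDerivAt y ((a t)⁻¹ • V t) t)
    (hV : ∀ t, 0 ≤ t → HasDerivAt V (-((derivWithin a (Ici 0) t / a t) • V t -
      (derivWithin a (Ici 0) t / a t * (‖V t‖ ^ 2 / c ^ 2)) • V t)) t)
    (h0 : w₀ (y 0) = V 0) {t : ℝ} (ht : t ∈ Ico 0 T) : w t (y t) = V t := by
  have hyc : ContinuousOn y (Ici 0) := fun s hs => (hy s hs).continuousAt.continuousWithinAt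
  have hVc : ContinuousOn V (Ici 0) := fun s hs => (hV s hs).continuousAt.continuousWithinAt
  have hsub : Icc 0 t ⊆ Ico 0 T := fun s hs => ⟨hs.1, hs.2.trans_lt ht.2⟩
  have hsub' : Icc 0 t ⊆ Ici 0 := fun s hs => hs.1
  set h : ℝ → ℝ := fun s => derivWithin a (Ici 0) s / a s with hh
  have hhc : ContinuousOn h (Icc 0 t) :=
    (ha'.mono hsub').div (ha.mono hsub') fun s hs => ha0 s hs.1
  have hac : ContinuousOn (fun s => (a s)⁻¹) (Icc 0 t) :=
    (ha.mono hsub').inv₀ fun s hs => ha0 s hs.1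
  set D : ℝ → _ := fun s => fderiv ℝ (w s) (y s)
  have hDc : ContinuousOn D (Icc 0 t) :=
    (continuousOn_fderiv_along_curve hw.contDiffOn hyc).mono hsub
  set W : ℝ → EuclideanSpace ℝ (Fin n) := fun s => w s (y s)
  have hWc : ContinuousOn W (Icc 0 t) := (continuousOn_along_curve hw.contDiffOn hyc).mono hsub
  have hVc' : ContinuousOn V (Icc 0 t) := hVc.mono hsub'
  -- `K` is the Grönwall constant for `W - V`. The curve `y` is the known characteristic, not one of
  -- `w`, so `∇w` is needed only along a compact arc; the mismatch of transport speeds contributes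
  -- `a⁻¹ ∇w (W - V)`.
  obtain ⟨K, hK⟩ := isCompact_Icc.exists_bound_of_continuousOn (s := Icc 0 t)
    (f := fun s => ‖(a s)⁻¹‖ * ‖D s‖ +
      (‖h s‖ + ‖h s / c ^ 2‖ * (‖W s‖ ^ 2 + (‖W s‖ + ‖V s‖) * ‖V s‖)))
    (by
      have hhc2 : ContinuousOn (fun s => h s / c ^ 2) (Icc 0 t) := hhc.div_const _
      fun_prop)
  have hder : ∀ s ∈ Icc 0 t, HasDerivWithinAt (fun s => W s - V s)
      (-((a s)⁻¹ • D s (W s - V s)) - (h s • (W s - V s) -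
        (h s / c ^ 2) • (‖W s‖ ^ 2 • W s - ‖V s‖ ^ 2 • V s))) (Ici 0) s := by
    intro s hs
    have h1 := hasDerivWithinAt_along_curve hw.contDiffOn (hsub hs) (hy s hs.1)
    refine (h1.sub (hV s hs.1).hasDerivWithinAt).congr_deriv ?_
    have h2 := hw.equation s (hsub hs) (y s)
    have h3 : derivWithin (fun r => w r (y s)) (Ici 0) s = -((a s)⁻¹ • D s (W s)
      + h s • W s - (h s * (‖W s‖ ^ 2 / c ^ 2)) • W s) := by
      rw [eq_neg_iff_add_eq_zero, ← h2, one_div]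
      simp only [W, D, h]
      abel
    rw [h3, map_smul, map_sub]
    module
  have hz := eq_zero_of_abs_deriv_le_mul_abs_self_of_eq_zero_right (a := 0) (b := t) (K := K)
    (f := fun s => W s - V s) (hWc.sub hVc')
    (fun s hs => (hder s ⟨hs.1, hs.2.le⟩).mono (Ici_subset_Ici.2 hs.1))
    (by simp only [W, hw.initial (ht.1.trans_lt ht.2), h0, sub_self])
    (fun s hs => ?_) t ⟨ht.1, le_rfl⟩
  · exact sub_eq_zero.1 hz
  · have hs' : s ∈ Icc 0 t := ⟨hs.1, hs.2.le⟩
    have hk := (le_abs_self _).trans (hK s hs')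
    refine le_trans ?_ (mul_le_mul_of_nonneg_right hk (norm_nonneg _))
    refine (norm_sub_le _ _).trans ?_
    rw [add_mul]
    refine add_le_add ?_ ((norm_sub_le _ _).trans ?_)
    · rw [norm_neg, norm_smul, mul_assoc]
      gcongr
      exact (D s).le_opNorm _
    · rw [add_mul]
      refine add_le_add (norm_smul_le _ _) ?_
      rw [norm_smul, mul_assoc]
      gcongr
      exact norm_sq_smul_sub_le _ _

/-- A `C¹` field which takes the prescribed values along one characteristic satisfies the
equation on that characteristic. -/
lemma equation_of_eq_along_characteristic
    (hw : ContDiffOn ℝ 1 (fun p : ℝ × EuclideanSpace ℝ (Fin n) => w p.1 p.2) (Ico 0 T ×ˢ univ))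
    (hy : ∀ t, 0 ≤ t → HasDerivAt y ((a t)⁻¹ • V t) t)
    (hV : ∀ t, 0 ≤ t → HasDerivAt V (-((derivWithin a (Ici 0) t / a t) • V t -
      (derivWithin a (Ici 0) t / a t * (‖V t‖ ^ 2 / c ^ 2)) • V t)) t)
    (hwV : ∀ t ∈ Ico 0 T, w t (y t) = V t) {t : ℝ} (ht : t ∈ Ico 0 T) :
    derivWithin (fun s => w s (y t)) (Ici 0) t
      + (1 / a t) • fderiv ℝ (w t) (y t) (w t (y t))
      + (derivWithin a (Ici 0) t / a t) • w t (y t)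
      - (derivWithin a (Ici 0) t / a t * (‖w t (y t)‖ ^ 2 / c ^ 2)) • w t (y t) = 0 := by
  have h1 := hasDerivWithinAt_along_curve hw ht (hy t ht.1)
  have h2 : HasDerivWithinAt (fun s => w s (y s)) _ (Ici 0) t :=
    (hV t ht.1).hasDerivWithinAt.congr_of_eventuallyEq_of_mem
      (eventually_of_mem (Ico_mem_nhdsWithin_Ici_zero ht) hwV) ht.1
  have h3 := (uniqueDiffOn_Ici (0 : ℝ) t ht.1).eq_deriv _ h1 h2
  rw [map_smul] at h3
  rw [hwV t ht, one_div, h3]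
  abel

end Characteristics

/-! ### The Lagrangian flow and its least stretch. -/

noncomputable section Flow

variable {E : Type*} [NormedAddCommGroup E] [InnerProductSpace ℝ E]

/-- Comoving position at time `t` of the particle which starts at `α` with momentum `m α`. -/
def position (c : ℝ) (A : ℝ → ℝ) (m : E → E) (t : ℝ) (α : E) : E :=
  α + displacement c A t (m α)

/-- Velocity at time `t` of the particle which starts at `α` with momentum `m α`. -/
def velocity (c : ℝ) (A : ℝ → ℝ) (m : E → E) (t : ℝ) (α : E) : E :=
  velocityOf c ((A t)⁻¹ • m α)

/-- The least factor by which the flow stretches a tangent vector at time `t`. -/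
def leastStretch (c : ℝ) (A : ℝ → ℝ) (m : E → E) (t : ℝ) : ℝ :=
  ⨅ x : E × Metric.sphere (0 : E) 1, ‖fderiv ℝ (position c A m t) x.1 x.2‖

variable {c : ℝ} {A : ℝ → ℝ} {m : E → E}

lemma position_zero (α : E) : position c A m 0 α = α := by simp [position, displacement_zero]

lemma velocity_zero (hA : IsRegularScale A) (α : E) :
    velocity c A m 0 α = velocityOf c (m α) := by simp [velocity, hA.init]

lemma norm_position_sub_le (hc : 0 < c) (hA : IsRegularScale A) {t : ℝ} (ht : 0 ≤ t) (α : E) :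
    ‖position c A m t α - α‖ ≤ c * t := by
  rw [position, add_sub_cancel_left]
  exact norm_displacement_le hc hA ht _

lemma hasDerivAt_position [CompleteSpace E] (hA : IsRegularScale A) (t : ℝ) (α : E) :
    HasDerivAt (fun t => position c A m t α) ((A t)⁻¹ • velocity c A m t α) t :=
  (hasDerivAt_displacement hA t (m α)).const_add α

lemma contDiff_velocity (hA : IsRegularScale A) (hm : ContDiff ℝ 1 m) :
    ContDiff ℝ 1 fun x : ℝ × E => velocity c A m x.1 x.2 :=
  (contDiff_velocityOf c).comp
    (((hA.contDiff.inv hA.ne_zero).comp contDiff_fst).smul (hm.comp contDiff_snd))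

lemma fderiv_velocity (hm : ContDiff ℝ 1 m) (t : ℝ) (α : E) :
    fderiv ℝ (velocity c A m t) α =
      ((A t)⁻¹ • fderiv ℝ (velocityOf c) ((A t)⁻¹ • m α)).comp (fderiv ℝ m α) :=
  ((hasFDerivAt_velocityOf_smul c (A t)⁻¹ (m α)).comp α
    (hm.differentiable one_ne_zero α).hasFDerivAt).fderiv

variable [FiniteDimensional ℝ E]

lemma contDiff_position (hA : IsRegularScale A) (hm : ContDiff ℝ 1 m) :
    ContDiff ℝ 1 fun x : ℝ × E => position c A m x.1 x.2 := by
  have h1 : ContDiff ℝ 1 fun x : ℝ × E => (x.1, m x.2) :=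
    contDiff_fst.prodMk (hm.comp contDiff_snd)
  have h2 := (contDiff_displacement (E := E) (c := c) hA).comp h1
  exact contDiff_snd.add h2

lemma fderiv_position (hA : IsRegularScale A) (hm : ContDiff ℝ 1 m) (t : ℝ) (α : E) :
    fderiv ℝ (position c A m t) α =
      ContinuousLinearMap.id ℝ E + (displacementDeriv c A t (m α)).comp (fderiv ℝ m α) :=
  ((hasFDerivAt_id α).add ((hasFDerivAt_displacement hA t (m α)).comp α
    (hm.differentiable one_ne_zero α).hasFDerivAt)).fderiv

/-- Position and velocity cannot both be insensitive to the label. -/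
lemma exists_norm_le_fderiv_position_add (hc : 0 < c) (hA : IsRegularScale A)
    (hm : ContDiff ℝ 1 m) {R : ℝ} (hR : ∀ α, ‖m α‖ ≤ R) {S : ℝ} (hS : 0 ≤ S) :
    ∃ κ : ℝ, 0 ≤ κ ∧ ∀ t ∈ Icc 0 S, ∀ α e, ‖e‖ ≤ ‖fderiv ℝ (position c A m t) α e‖ +
      κ * ‖fderiv ℝ (velocity c A m t) α e‖ := by
  obtain ⟨M, hM0, hM⟩ := exists_norm_displacementDeriv_sub_le (E := E) hA c R
  obtain ⟨C, hC0, hC⟩ := exists_norm_le_fderiv_velocityOf (E := E) hc R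
  obtain ⟨B, hB⟩ := isCompact_Icc.exists_bound_of_continuousOn (s := Icc 0 S)
    hA.continuous.continuousOn
  have hB0 : 0 ≤ B := (norm_nonneg _).trans (hB 0 ⟨le_rfl, hS⟩)
  -- With `f = Dm e` one has `e = DX e - D f`. Here `M * S` bounds `D` up to time `S`, and `C * B`
  -- bounds `f` by `DV e`, since `D(velocityOf)` is bounded below by `1/C` and `A` is at most `B`.
  refine ⟨M * S * (C * B), by positivity, fun t ht α e => ?_⟩
  set f := fderiv ℝ m α e
  have hDX : fderiv ℝ (position c A m t) α e = e + displacementDeriv c A t (m α) f := by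
    rw [fderiv_position hA hm]; rfl
  have hDV : fderiv ℝ (velocity c A m t) α e =
      (A t)⁻¹ • fderiv ℝ (velocityOf c) ((A t)⁻¹ • m α) f := by
    rw [fderiv_velocity hm]; rfl
  have h1 : ‖displacementDeriv c A t (m α) f‖ ≤ M * S * ‖f‖ := by
    refine (ContinuousLinearMap.le_opNorm _ _).trans ?_
    gcongr
    have := hM (m α) (hR α) 0 t le_rfl ht.1
    rw [displacementDeriv_zero, sub_zero, sub_zero, abs_of_nonneg ht.1] at this
    exact this.trans (mul_le_mul_of_nonneg_left ht.2 hM0)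
  have h2 : ‖f‖ ≤ C * B * ‖fderiv ℝ (velocity c A m t) α e‖ := by
    rw [hDV, norm_smul, norm_inv]
    have hA0 : 0 < ‖A t‖ := norm_pos_iff.2 (hA.ne_zero t)
    calc ‖f‖ ≤ C * ‖fderiv ℝ (velocityOf c) ((A t)⁻¹ • m α) f‖ :=
          hC _ ((hA.norm_inv_smul_le ht.1 _).trans (hR α)) f
      _ = C * ‖A t‖ * (‖A t‖⁻¹ * ‖fderiv ℝ (velocityOf c) ((A t)⁻¹ • m α) f‖) := by
          field_simp
      _ ≤ _ := by
          gcongr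
          exact hB t ht
  have h3 : ‖e‖ ≤ ‖fderiv ℝ (position c A m t) α e‖ + ‖displacementDeriv c A t (m α) f‖ := by
    rw [hDX]
    simpa using norm_sub_le (e + displacementDeriv c A t (m α) f) (displacementDeriv c A t (m α) f)
  calc ‖e‖ ≤ ‖fderiv ℝ (position c A m t) α e‖ + M * S * ‖f‖ := by linarith
    _ ≤ ‖fderiv ℝ (position c A m t) α e‖ +
        M * S * (C * B * ‖fderiv ℝ (velocity c A m t) α e‖) := by gcongr
    _ = _ := by ring

lemma exists_norm_fderiv_velocity_le (hA : IsRegularScale A) (hm : ContDiff ℝ 1 m) {R L : ℝ}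
    (hR : ∀ α, ‖m α‖ ≤ R) (hL : ∀ α, ‖fderiv ℝ m α‖ ≤ L) (c : ℝ) :
    ∃ B : ℝ, 0 ≤ B ∧ ∀ t, 0 ≤ t → ∀ α, ‖fderiv ℝ (velocity c A m t) α‖ ≤ B := by
  obtain ⟨M, hM⟩ := (isCompact_closedBall (0 : E) R).exists_bound_of_continuousOn
    (continuous_fderiv_velocityOf (E := E) c).continuousOn
  have hL0 : 0 ≤ L := (norm_nonneg _).trans (hL 0)
  refine ⟨max M 0 * L, by positivity, fun t ht α => ?_⟩
  rw [fderiv_velocity hm]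
  refine (ContinuousLinearMap.opNorm_comp_le _ _).trans ?_
  gcongr
  · rw [norm_smul, norm_inv, Real.norm_of_nonneg (hA.pos t).le]
    calc (A t)⁻¹ * ‖fderiv ℝ (velocityOf c) ((A t)⁻¹ • m α)‖ ≤ 1 * M := by
          gcongr
          · exact inv_le_one_of_one_le₀ (hA.one_le t ht)
          · exact hM _ (by simpa using (hA.norm_inv_smul_le ht _).trans (hR α))
      _ ≤ max M 0 := by rw [one_mul]; exact le_max_left _ _
  · exact hL α

section LeastStretch

omit [FiniteDimensional ℝ E] in
lemma bddBelow_stretch (t : ℝ) : BddBelow (range fun x : E × Metric.sphere (0 : E) 1 =>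
    ‖fderiv ℝ (position c A m t) x.1 x.2‖) :=
  ⟨0, by rintro _ ⟨x, rfl⟩; exact norm_nonneg _⟩

omit [FiniteDimensional ℝ E] in
lemma leastStretch_nonneg (t : ℝ) : 0 ≤ leastStretch c A m t :=
  Real.iInf_nonneg fun _ => norm_nonneg _

omit [FiniteDimensional ℝ E] in
lemma leastStretch_mul_norm_le (t : ℝ) (α e : E) :
    leastStretch c A m t * ‖e‖ ≤ ‖fderiv ℝ (position c A m t) α e‖ := by
  rcases eq_or_ne e 0 with rfl | he
  · simp
  have hn : 0 < ‖e‖ := norm_pos_iff.2 he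
  have h := ciInf_le (bddBelow_stretch (c := c) (A := A) (m := m) t)
    (α, ⟨‖e‖⁻¹ • e, by simp [norm_smul, hn.ne']⟩)
  simp only [map_smul, norm_smul, norm_inv, norm_norm] at h
  rwa [le_inv_mul_iff₀ hn, mul_comm] at h

variable [Nontrivial E]

omit [FiniteDimensional ℝ E] in
lemma nonempty_label_sphere : Nonempty (E × Metric.sphere (0 : E) 1) := by
  have := (NormedSpace.sphere_nonempty (x := (0 : E)) (r := 1)).2 zero_le_one
  exact ⟨0, this.some, this.some_mem⟩

omit [FiniteDimensional ℝ E] in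
lemma exists_norm_lt_of_leastStretch_lt {t δ : ℝ} (h : leastStretch c A m t < δ) :
    ∃ α e : E, ‖e‖ = 1 ∧ ‖fderiv ℝ (position c A m t) α e‖ < δ := by
  have := nonempty_label_sphere (E := E)
  obtain ⟨⟨α, e, he⟩, hx⟩ := exists_lt_of_ciInf_lt h
  exact ⟨α, e, by simpa using he, hx⟩

omit [FiniteDimensional ℝ E] in
lemma leastStretch_zero : leastStretch c A m 0 = 1 := by
  have := nonempty_label_sphere (E := E)
  have h : position c A m 0 = id := funext position_zero
  have h2 : ∀ x : E × Metric.sphere (0 : E) 1,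
      ‖fderiv ℝ (position c A m 0) x.1 x.2‖ = 1 := by
    intro x
    rw [h, fderiv_id]
    simp
  simp [leastStretch, h2]

/-- An infimum of functions with a common Lipschitz constant in time is Lipschitz. The uniform
bounds on `m` and `Dm` replace compactness of the set of labels. -/
lemma continuousOn_leastStretch (hA : IsRegularScale A)
    (hm : ContDiff ℝ 1 m) {R L : ℝ} (hR : ∀ α, ‖m α‖ ≤ R) (hL : ∀ α, ‖fderiv ℝ m α‖ ≤ L) :
    ContinuousOn (leastStretch c A m) (Ici 0) := by
  have := nonempty_label_sphere (E := E)
  obtain ⟨M, hM0, hM⟩ := exists_norm_displacementDeriv_sub_le (E := E) hA c R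
  have hL0 : 0 ≤ L := (norm_nonneg _).trans (hL 0)
  have key : ∀ s ∈ Ici (0 : ℝ), ∀ t ∈ Ici (0 : ℝ),
      leastStretch c A m s ≤ leastStretch c A m t + M * L * dist s t := by
    intro s hs t ht
    rw [← sub_le_iff_le_add]
    refine le_ciInf fun x => ?_
    obtain ⟨α, e, he⟩ := x
    have he1 : ‖e‖ = 1 := by simpa using he
    have h1 := leastStretch_mul_norm_le (c := c) (A := A) (m := m) s α e
    rw [he1, mul_one] at h1
    have h2 : ‖fderiv ℝ (position c A m s) α e - fderiv ℝ (position c A m t) α e‖ ≤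
        M * L * dist s t := by
      rw [fderiv_position hA hm, fderiv_position hA hm, ← sub_apply,
        add_sub_add_left_eq_sub, ← ContinuousLinearMap.sub_comp]
      refine (ContinuousLinearMap.le_opNorm _ _).trans ?_
      rw [he1, mul_one, Real.dist_eq]
      calc _ ≤ ‖displacementDeriv c A s (m α) - displacementDeriv c A t (m α)‖ *
            ‖fderiv ℝ m α‖ := ContinuousLinearMap.opNorm_comp_le _ _
        _ ≤ (M * |s - t|) * L := by
            gcongr
            · exact hM _ (hR α) t s ht hs
            · exact hL α
        _ = M * L * |s - t| := by ring
    have h3 := norm_le_norm_add_norm_sub (fderiv ℝ (position c A m t) α e)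
      (fderiv ℝ (position c A m s) α e)
    rw [norm_sub_rev] at h3
    simp only
    linarith
  exact (LipschitzOnWith.of_le_add_mul ⟨M * L, by positivity⟩ key).continuousOn

end LeastStretch

end Flow

/-! ### Formation of singularities and size of the gradient. -/

noncomputable section Singular

variable {E : Type*} [NormedAddCommGroup E] [InnerProductSpace ℝ E] [FiniteDimensional ℝ E]
  {c : ℝ} {A : ℝ → ℝ} {m : E → E}

/-- At time `0` the flow is the identity and the determinant is `1`; by the intermediate value
theorem it vanishes before `t`. -/
lemma exists_singular_of_det_neg (hA : IsRegularScale A) (hm : ContDiff ℝ 1 m) {t : ℝ} (ht : 0 ≤ t)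
    {α : E} (hdet : (fderiv ℝ (position c A m t) α).det < 0) :
    ∃ s, 0 ≤ s ∧ ∃ α e, e ≠ 0 ∧ fderiv ℝ (position c A m s) α e = 0 := by
  have hX := contDiff_position (c := c) hA hm
  have hc : Continuous fun s => fderiv ℝ (position c A m s) α := by
    have h1 : Continuous fun s : ℝ =>
        (fderiv ℝ (fun x : ℝ × E => position c A m x.1 x.2) (s, α)).comp
          (ContinuousLinearMap.inr ℝ ℝ E) :=
      ((hX.continuous_fderiv one_ne_zero).comp
        (by fun_prop : Continuous fun s : ℝ => (s, α))).clm_comp continuous_const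
    exact h1.congr fun s => (hasFDerivAt_slice hX s α).fderiv.symm
  have hdc : Continuous fun s => (fderiv ℝ (position c A m s) α).det :=
    ContinuousLinearMap.continuous_det.comp hc
  have h0 : (fderiv ℝ (position c A m 0) α).det = 1 := by
    rw [show position c A m 0 = id from funext position_zero, fderiv_id]
    exact LinearMap.det_id
  obtain ⟨s, hs, hs0⟩ := intermediate_value_Icc' ht hdc.continuousOn
    (show (0 : ℝ) ∈ Icc _ _ from ⟨hdet.le, by rw [h0]; exact zero_le_one⟩)
  obtain ⟨e, he, he0⟩ := (Submodule.ne_bot_iff _).1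
    (LinearMap.bot_lt_ker_of_det_eq_zero (f := (fderiv ℝ (position c A m s) α : E →ₗ[ℝ] E)) hs0).ne'
  exact ⟨s, hs.1, α, e, he0, he⟩

omit [FiniteDimensional ℝ E] in
-- Openness of `det < 0`. The radius `η` depends on `B` alone, so the smallness of the data can be
-- fixed before the scale factor.
lemma exists_forall_det_neg {B : E →L[ℝ] E} (hB : B.det < 0) :
    ∃ η : ℝ, 0 < η ∧ ∀ (P N : E →L[ℝ] E) (r : ℝ), ‖P - ContinuousLinearMap.id ℝ E‖ < η →
      ‖N - ContinuousLinearMap.id ℝ E‖ < η → |r| < η →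
        (r • ContinuousLinearMap.id ℝ E + P.comp (N.comp B)).det < 0 := by
  have hc : Continuous fun x : (E →L[ℝ] E) × (E →L[ℝ] E) × ℝ =>
      (x.2.2 • ContinuousLinearMap.id ℝ E + x.1.comp (x.2.1.comp B)).det := by
    refine ContinuousLinearMap.continuous_det.comp ?_
    fun_prop
  have h0 : ((0 : ℝ) • ContinuousLinearMap.id ℝ E + (ContinuousLinearMap.id ℝ E).comp
      ((ContinuousLinearMap.id ℝ E).comp B)).det < 0 := by
    simpa using hB
  have h1 := (hc.tendsto (ContinuousLinearMap.id ℝ E, ContinuousLinearMap.id ℝ E, (0 : ℝ))).eventually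
    (Iio_mem_nhds h0)
  obtain ⟨η, hη, h⟩ := Metric.eventually_nhds_iff.1 h1
  refine ⟨η, hη, fun P N r hP hN hr => h (y := (P, N, r)) ?_⟩
  rw [Prod.dist_eq, Prod.dist_eq, max_lt_iff, max_lt_iff, dist_eq_norm, dist_eq_norm,
    Real.dist_eq, sub_zero]
  exact ⟨hP, hN, hr⟩

/-- A label where the determinant of the initial field is negative makes the flow singular, provided
that the field is small. -/
lemma exists_singular_of_small (hA : IsRegularScale A) (hm : ContDiff ℝ 1 m)
    (hΛ : Tendsto (fun t => ∫ s in (0 : ℝ)..t, ((A s) ^ 2)⁻¹) atTop atTop)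
    {B N : E →L[ℝ] E} {η ρ ε : ℝ} {α : E} (hε : 0 < ε) (hη : 0 < η)
    (hdet : ∀ (P N : E →L[ℝ] E) (r : ℝ), ‖P - ContinuousLinearMap.id ℝ E‖ < η →
      ‖N - ContinuousLinearMap.id ℝ E‖ < η → |r| < η →
        (r • ContinuousLinearMap.id ℝ E + P.comp (N.comp B)).det < 0)
    (hN : ‖N - ContinuousLinearMap.id ℝ E‖ < η)
    (hρ : ∀ q : E, ‖q‖ ≤ ρ → ‖fderiv ℝ (velocityOf c) q - ContinuousLinearMap.id ℝ E‖ ≤ η / 2)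
    (hmρ : ‖m α‖ ≤ ρ) (hmd : fderiv ℝ m α = N.comp (ε • B)) :
    ∃ s, 0 ≤ s ∧ ∃ α e, e ≠ 0 ∧ fderiv ℝ (position c A m s) α e = 0 := by
  -- The threshold makes `(εΛ)⁻¹ < η`, so that the identity in `DX / (εΛ)` is a negligible term.
  obtain ⟨t, ht, hΛt⟩ := ((eventually_ge_atTop (0 : ℝ)).and
    (hΛ.eventually_gt_atTop (ε * η)⁻¹)).exists
  set Λ := ∫ s in (0 : ℝ)..t, ((A s) ^ 2)⁻¹
  have hεη : 0 < (ε * η)⁻¹ := by positivity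
  have hΛ0 : 0 < Λ := hεη.trans hΛt
  refine exists_singular_of_det_neg hA hm ht (α := α) ?_
  have hform : fderiv ℝ (position c A m t) α = (ε * Λ) • ((ε * Λ)⁻¹ • ContinuousLinearMap.id ℝ E +
      (Λ⁻¹ • displacementDeriv c A t (m α)).comp (N.comp B)) := by
    rw [fderiv_position hA hm, hmd]
    ext e
    simp only [add_apply, smul_apply, ContinuousLinearMap.comp_apply, map_smul, smul_add, smul_smul]
    congr 1
    · rw [mul_inv_cancel₀ (by positivity), one_smul]
    · rw [mul_assoc, mul_inv_cancel₀ hΛ0.ne', mul_one]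
  have hneg := hdet (Λ⁻¹ • displacementDeriv c A t (m α)) N (ε * Λ)⁻¹ ?_ hN ?_
  · rw [hform, ContinuousLinearMap.det, ContinuousLinearMap.toLinearMap_smul, LinearMap.det_smul]
    exact mul_neg_of_pos_of_neg (by positivity) hneg
  · have h := norm_displacementDeriv_sub_le hA hρ hmρ ht
    have h2 : Λ⁻¹ • displacementDeriv c A t (m α) - ContinuousLinearMap.id ℝ E =
        Λ⁻¹ • (displacementDeriv c A t (m α) - Λ • ContinuousLinearMap.id ℝ E) := by
      rw [smul_sub, smul_smul, inv_mul_cancel₀ hΛ0.ne', one_smul]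
    rw [h2, norm_smul, norm_inv, Real.norm_of_nonneg hΛ0.le, inv_mul_lt_iff₀ hΛ0]
    calc _ ≤ η / 2 * Λ := h
      _ < Λ * η := by nlinarith [mul_pos hη hΛ0]
  · rw [abs_of_pos (by positivity)]
    rw [inv_lt_comm₀ (by positivity) hη]
    rw [inv_lt_iff_one_lt_mul₀ (by positivity)] at hΛt
    rw [inv_lt_iff_one_lt_mul₀ hη]
    linarith

variable {T : ℝ} {v : ℝ → E → E}

omit [FiniteDimensional ℝ E] in
lemma leastStretch_eq_zero {t : ℝ} {α e : E} (he : e ≠ 0)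
    (h : fderiv ℝ (position c A m t) α e = 0) : leastStretch c A m t = 0 := by
  have h1 := leastStretch_mul_norm_le (c := c) (A := A) (m := m) t α e
  rw [h, norm_zero] at h1
  have h2 := leastStretch_nonneg (c := c) (A := A) (m := m) t
  have h3 : 0 < ‖e‖ := norm_pos_iff.2 he
  nlinarith

/-- Chain rule for `v ∘ X = V`, the bridge between the Eulerian gradient and the explicit flow. It
serves the constructed solution and any competing one alike. -/
lemma fderiv_apply_fderiv_position (hA : IsRegularScale A) (hm : ContDiff ℝ 1 m) {t : ℝ}
    (hvd : Differentiable ℝ (v t)) (hv : ∀ α, v t (position c A m t α) = velocity c A m t α)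
    (α e : E) :
    fderiv ℝ (v t) (position c A m t α) (fderiv ℝ (position c A m t) α e) =
      fderiv ℝ (velocity c A m t) α e := by
  have h : v t ∘ position c A m t = velocity c A m t := funext hv
  rw [← h, fderiv_comp α (hvd _) (hasFDerivAt_slice (contDiff_position hA hm) t α).differentiableAt]
  rfl

variable [Nontrivial E]

/-- As long as the flow does not degenerate, the gradient is bounded. -/
lemma exists_norm_fderiv_le (hA : IsRegularScale A) (hm : ContDiff ℝ 1 m) {R L : ℝ}
    (hR : ∀ α, ‖m α‖ ≤ R) (hL : ∀ α, ‖fderiv ℝ m α‖ ≤ L)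
    (hvd : ∀ t ∈ Ico 0 T, Differentiable ℝ (v t))
    (hsurj : ∀ t ∈ Ico 0 T, Function.Surjective (position c A m t))
    (hv : ∀ t ∈ Ico 0 T, ∀ α, v t (position c A m t α) = velocity c A m t α)
    {t : ℝ} (ht : t ∈ Ico 0 T) (hpos : ∀ s ∈ Icc 0 t, 0 < leastStretch c A m s) :
    ∃ C : ℝ, ∀ s ∈ Icc 0 t, ∀ x, ‖fderiv ℝ (v s) x‖ ≤ C := by
  obtain ⟨B, hB0, hB⟩ := exists_norm_fderiv_velocity_le hA hm hR hL c
  obtain ⟨r, hr, hmin⟩ := isCompact_Icc.exists_isMinOn ⟨0, le_rfl, ht.1⟩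
    ((continuousOn_leastStretch (c := c) hA hm hR hL).mono (fun s hs => hs.1 : Icc 0 t ⊆ Ici 0))
  set δ := leastStretch c A m r
  have hδ : 0 < δ := hpos r hr
  -- `∇v = DV ∘ (DX)⁻¹`, where `B` bounds `DV` and `DX` stretches by at least `δ`, the minimum of
  -- the least stretch on `[0, t]`.
  refine ⟨B / δ, fun s hs x => ?_⟩
  have hsT : s ∈ Ico 0 T := ⟨hs.1, hs.2.trans_lt ht.2⟩
  obtain ⟨α, rfl⟩ := hsurj s hsT x
  have hlow : ∀ e, δ * ‖e‖ ≤ ‖fderiv ℝ (position c A m s) α e‖ := fun e =>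
    (mul_le_mul_of_nonneg_right (hmin hs) (norm_nonneg e)).trans (leastStretch_mul_norm_le s α e)
  have hinj : Function.Injective (fderiv ℝ (position c A m s) α : E →ₗ[ℝ] E) := by
    rw [← LinearMap.ker_eq_bot, LinearMap.ker_eq_bot']
    intro e he
    have h1 := hlow e
    rw [show fderiv ℝ (position c A m s) α e = 0 from he, norm_zero] at h1
    exact norm_le_zero_iff.1 (nonpos_of_mul_nonpos_right h1 hδ)
  refine ContinuousLinearMap.opNorm_le_bound _ (by positivity) fun f => ?_
  obtain ⟨e, he⟩ := LinearMap.injective_iff_surjective.1 hinj f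
  have he : fderiv ℝ (position c A m s) α e = f := he
  rw [← he, fderiv_apply_fderiv_position hA hm (hvd s hsT) (hv s hsT)]
  calc ‖fderiv ℝ (velocity c A m s) α e‖ ≤ B * ‖e‖ :=
        (ContinuousLinearMap.le_opNorm _ _).trans (by gcongr; exact hB s hs.1 α)
    _ = B / δ * (δ * ‖e‖) := by field_simp
    _ ≤ B / δ * ‖fderiv ℝ (position c A m s) α e‖ := by gcongr; exact hlow e

/-- The gradient tends to infinity at a time when the flow degenerates. -/
lemma tendsto_iSup_enorm_fderiv (hc : 0 < c) (hA : IsRegularScale A) (hm : ContDiff ℝ 1 m)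
    {R L : ℝ} (hR : ∀ α, ‖m α‖ ≤ R) (hL : ∀ α, ‖fderiv ℝ m α‖ ≤ L)
    (hvd : ∀ t ∈ Ico 0 T, Differentiable ℝ (v t))
    (hv : ∀ t ∈ Ico 0 T, ∀ α, v t (position c A m t α) = velocity c A m t α)
    {S : ℝ} (hS : 0 < S) (hST : S ≤ T) (hzero : leastStretch c A m S = 0) :
    Tendsto (fun t => ⨆ x, ‖fderiv ℝ (v t) x‖ₑ) (𝓝[<] S) (𝓝 ⊤) := by
  obtain ⟨κ, hκ0, hκ⟩ := exists_norm_le_fderiv_position_add hc hA hm hR hS.le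
  rw [ENNReal.tendsto_nhds_top_iff_nnreal]
  intro N
  -- If `|∇v| ≤ N` at the chosen point, a unit vector `e` with `|DX e| < δ` would satisfy `1 ≤ δ +
  -- κNδ`; this `δ` makes the right side `1/2`.
  set δ : ℝ := (2 * (1 + κ * N))⁻¹
  have hδ : 0 < δ := by positivity
  have hIco : ∀ᶠ t in 𝓝[<] S, t ∈ Ioo 0 S := Ioo_mem_nhdsLT hS
  have hsmall : ∀ᶠ t in 𝓝[<] S, leastStretch c A m t < δ := by
    have h1 := (continuousOn_leastStretch (c := c) hA hm hR hL).continuousAt (Ici_mem_nhds hS)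
    have h2 : Tendsto (leastStretch c A m) (𝓝[<] S) (𝓝 0) := by
      rw [← hzero]
      exact h1.tendsto.mono_left nhdsWithin_le_nhds
    exact h2.eventually (Iio_mem_nhds hδ)
  filter_upwards [hIco, hsmall] with t ht htδ
  obtain ⟨α, e, he, hlt⟩ := exists_norm_lt_of_leastStretch_lt htδ
  have htT : t ∈ Ico 0 T := ⟨ht.1.le, ht.2.trans_le hST⟩
  refine lt_of_lt_of_le ?_ (le_iSup (fun x => ‖fderiv ℝ (v t) x‖ₑ) (position c A m t α))
  rw [enorm_eq_nnnorm, ENNReal.coe_lt_coe, ← NNReal.coe_lt_coe, coe_nnnorm]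
  by_contra! hle
  have h1 := hκ t ⟨ht.1.le, ht.2.le⟩ α e
  rw [he, ← fderiv_apply_fderiv_position hA hm (hvd t htT) (hv t htT)] at h1
  have h2 : ‖fderiv ℝ (v t) (position c A m t α) (fderiv ℝ (position c A m t) α e)‖ ≤ N * δ :=
    (ContinuousLinearMap.le_opNorm _ _).trans (by gcongr)
  have h3 : (1 : ℝ) ≤ δ + κ * (N * δ) := h1.trans (by gcongr)
  have h4 : δ + κ * (N * δ) = 1 / 2 := by
    have : (1 : ℝ) + κ * N ≠ 0 := by positivity
    simp only [δ]
    field_simp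
  linarith

end Singular

/-! ### Blow-up and the choice of the smallness threshold. -/

/-- If the flow of the characteristics becomes singular, then the classical solution blows up. -/
lemma exists_blowup_of_singular {n : ℕ} [Nontrivial (EuclideanSpace ℝ (Fin n))] {c l : ℝ}
    {a A : ℝ → ℝ} {m : EuclideanSpace ℝ (Fin n) → EuclideanSpace ℝ (Fin n)} {R L : ℝ}
    (hc : 0 < c) (ha : IsSlowScaleFactor a l) (hA : IsRegularScale A)
    (hAa : ∀ t, 0 ≤ t → A t = a t)
    (hAd : ∀ t, 0 ≤ t → HasDerivAt A (derivWithin a (Ici 0) t) t)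
    (hm : ContDiff ℝ 1 m) (hR : ∀ α, ‖m α‖ ≤ R) (hL : ∀ α, ‖fderiv ℝ m α‖ ≤ L)
    (hsing : ∃ s, 0 ≤ s ∧ ∃ α e, e ≠ 0 ∧ fderiv ℝ (position c A m s) α e = 0) :
    ∃ (T : ℝ) (v : ℝ → EuclideanSpace ℝ (Fin n) → EuclideanSpace ℝ (Fin n)),
      0 < T ∧
      IsClassicalSolution c a (fun x => velocityOf c (m x)) T v ∧
      (∀ (T' : ℝ) (w : ℝ → EuclideanSpace ℝ (Fin n) → EuclideanSpace ℝ (Fin n)),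
        IsClassicalSolution c a (fun x => velocityOf c (m x)) T' w →
          T' ≤ T ∧ ∀ t ∈ Ico 0 T', w t = v t) ∧
      Tendsto (gradSup v) (𝓝[<] T) (𝓝 ⊤) ∧
      ∃ T₁ : ℝ, 0 < T₁ ∧ T₁ ≤ T ∧
        (∀ t ∈ Ico 0 T₁, ∃ C : ℝ, ∀ s ∈ Icc 0 t, ∀ x, ‖fderiv ℝ (v s) x‖ ≤ C) ∧
        Tendsto (gradSup v) (𝓝[<] T₁) (𝓝 ⊤) := by
  set X := position c A m
  set V := velocity c A m
  have hX : ContDiff ℝ 1 fun x : ℝ × EuclideanSpace ℝ (Fin n) => X x.1 x.2 :=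
    contDiff_position hA hm
  have hV : ContDiff ℝ 1 fun x : ℝ × EuclideanSpace ℝ (Fin n) => V x.1 x.2 :=
    contDiff_velocity hA hm
  have hXd : ∀ α t, 0 ≤ t → HasDerivAt (fun t => X t α) ((a t)⁻¹ • V t α) t := fun α t ht => by
    rw [← hAa t ht]
    exact hasDerivAt_position hA t α
  have hVd : ∀ α t, 0 ≤ t → HasDerivAt (fun t => V t α) (-((derivWithin a (Ici 0) t / a t) • V t α -
      (derivWithin a (Ici 0) t / a t * (‖V t α‖ ^ 2 / c ^ 2)) • V t α)) t := fun α t ht => by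
    rw [← hAa t ht]
    exact hasDerivAt_velocityOf_inv_smul hc (hAd t ht) hA.pos (m α)
  have hX0 : ∀ α, X 0 α = α := position_zero
  have hV0 : ∀ α, V 0 α = velocityOf c (m α) := velocity_zero hA
  -- `Sing` records degeneration at an actual label and governs existence of the solution; `Z` also
  -- includes degeneration only in the limit along labels, and governs boundedness of the gradient.
  -- As `Z` is closed and contains `Sing`, it contains `T = sInf Sing` even if no label is singular
  -- at time `T`.
  set Sing : Set ℝ := {s | 0 ≤ s ∧ ∃ α e, e ≠ 0 ∧ fderiv ℝ (X s) α e = 0}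
  set Z : Set ℝ := Ici 0 ∩ leastStretch c A m ⁻¹' {0}
  have hZ : IsClosed Z :=
    (continuousOn_leastStretch hA hm hR hL).preimage_isClosed_of_isClosed isClosed_Ici
      isClosed_singleton
  have hSZ : Sing ⊆ Z := fun s ⟨hs, α, e, he, h⟩ => ⟨hs, leastStretch_eq_zero he h⟩
  have hSb : BddBelow Sing := ⟨0, fun s hs => hs.1⟩
  have hZb : BddBelow Z := ⟨0, fun s hs => hs.1⟩
  set T := sInf Sing
  set T₁ := sInf Z
  have hTZ : T ∈ Z := closure_minimal hSZ hZ (csInf_mem_closure hsing hSb)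
  have hT₁Z : T₁ ∈ Z := hZ.csInf_mem ⟨T, hTZ⟩ hZb
  have hT₁T : T₁ ≤ T := csInf_le hZb hTZ
  have hT₁0 : 0 < T₁ := by
    refine lt_of_le_of_ne hT₁Z.1 fun h => ?_
    have h1 : leastStretch c A m T₁ = 0 := hT₁Z.2
    rw [← h, leastStretch_zero] at h1
    exact one_ne_zero h1
  have hT0 : 0 < T := hT₁0.trans_le hT₁T
  have hinj : ∀ t ∈ Ico 0 T, ∀ α e, fderiv ℝ (X t) α e = 0 → e = 0 := by
    intro t ht α e h
    by_contra he
    exact notMem_of_lt_csInf ht.2 hSb ⟨ht.1, α, e, he, h⟩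
  have hbd : ∀ s, 0 ≤ s → ∀ α, ‖X s α - α‖ ≤ c * s := fun s hs α => norm_position_sub_le hc hA hs α
  have hbij : ∀ t ∈ Ico 0 T, Function.Bijective (X t) := fun t ht =>
    ⟨injective_of_deformation hX hX0 ht.1 hbd hc.le fun s hs => hinj s ⟨hs.1, hs.2.trans_lt ht.2⟩,
      surjective_of_bounded_displacement hX (hbd t ht.1) (hinj t ht)⟩
  obtain ⟨v, hvc, hv⟩ := exists_eulerian_field hX hV hbij hinj
  have hvd : ∀ t ∈ Ico 0 T, Differentiable ℝ (v t) := fun t ht x =>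
    (hasFDerivAt_slice_of_strip hvc ht x).differentiableAt
  have hsol : IsClassicalSolution c a (fun x => velocityOf c (m x)) T v := by
    refine ⟨hvc, fun t ht x => ?_, fun _ => funext fun x => ?_⟩
    · obtain ⟨α, rfl⟩ := (hbij t ht).2 x
      exact equation_of_eq_along_characteristic hvc (hXd α) (hVd α) (fun s hs => hv s hs α) ht
    · have h := hv 0 ⟨le_rfl, hT0⟩ x
      rwa [hX0, hV0] at h
  have hgrad : ∀ S, 0 < S → S ≤ T → leastStretch c A m S = 0 →
      Tendsto (gradSup v) (𝓝[<] S) (𝓝 ⊤) := fun S hS hST h =>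
    tendsto_iSup_enorm_fderiv hc hA hm hR hL hvd hv hS hST h
  refine ⟨T, v, hT0, hsol, fun T' w hw => ?_, hgrad T hT0 le_rfl hTZ.2, T₁, hT₁0, hT₁T,
    fun t ht => ?_, hgrad T₁ hT₁0 hT₁T hT₁Z.2⟩
  · have hwV : ∀ t ∈ Ico 0 T', ∀ α, w t (X t α) = V t α := fun t ht α =>
      hw.eq_along_characteristic (y := fun t => X t α) (V := fun t => V t α) ha.diff.continuousOn
        (fun s hs => (ha.pos s hs).ne') ha.diff_deriv.continuousOn (hXd α) (hVd α)
        (by rw [hX0, hV0]) ht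
    have hT' : T' ≤ T := by
      by_contra! hlt
      -- A solution living past `T` would be differentiable at a time `s` with `DX e = 0`; then `DV
      -- e = ∇w (DX e) = 0`, and the two cannot vanish together for `e ≠ 0`.
      obtain ⟨s, ⟨hs0, α, e, he, hs⟩, hsT'⟩ := exists_lt_of_csInf_lt hsing hlt
      obtain ⟨κ, -, hκ⟩ := exists_norm_le_fderiv_position_add hc hA hm hR hs0
      have hsI : s ∈ Ico 0 T' := ⟨hs0, hsT'⟩
      have h1 := fderiv_apply_fderiv_position hA hm
        (fun x => (hasFDerivAt_slice_of_strip hw.contDiffOn hsI x).differentiableAt) (hwV s hsI) α e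
      have h2 := hκ s ⟨hs0, le_rfl⟩ α e
      rw [← h1, hs, map_zero, norm_zero, mul_zero, add_zero] at h2
      exact he (norm_le_zero_iff.1 h2)
    refine ⟨hT', fun t ht => funext fun x => ?_⟩
    have htT : t ∈ Ico 0 T := ⟨ht.1, ht.2.trans_le hT'⟩
    obtain ⟨α, rfl⟩ := (hbij t htT).2 x
    rw [hwV t ht, hv t htT]
  · refine exists_norm_fderiv_le hA hm hR hL hvd (fun s hs => (hbij s hs).2) hv
      ⟨ht.1, ht.2.trans_le hT₁T⟩ fun s hs => ?_
    refine lt_of_le_of_ne (leastStretch_nonneg s) fun h => ?_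
    exact notMem_of_lt_csInf (hs.2.trans_lt ht.2) hZb ⟨hs.1, h.symm⟩

theorem theorem2 (n : ℕ) (hn : 1 ≤ n) (c : ℝ) (hc : 0 < c)
    (v₀ : EuclideanSpace ℝ (Fin n) → EuclideanSpace ℝ (Fin n)) (hv₀ : IsBoundedC2 v₀)
    (hdet : (⨅ α : EuclideanSpace ℝ (Fin n), (fderiv ℝ v₀ α).det) < (0 : ℝ)) :
    ∃ ε₀ : ℝ, 0 < ε₀ ∧ ∀ (a : ℝ → ℝ) (l : ℝ), IsSlowScaleFactor a l → ∀ ε ∈ Ioc 0 ε₀,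
      ∃ (T : ℝ) (v : ℝ → EuclideanSpace ℝ (Fin n) → EuclideanSpace ℝ (Fin n)),
        0 < T ∧
        IsClassicalSolution c a (fun x => ε • v₀ x) T v ∧
        -- `v` is the unique classical solution and `[0, T)` is its maximal time interval
        (∀ (T' : ℝ) (w : ℝ → EuclideanSpace ℝ (Fin n) → EuclideanSpace ℝ (Fin n)),
          IsClassicalSolution c a (fun x => ε • v₀ x) T' w →
            T' ≤ T ∧ ∀ t ∈ Ico 0 T', w t = v t) ∧
        -- the gradient tends to infinity at the end of the maximal interval
        Tendsto (gradSup v) (𝓝[<] T) (𝓝 ⊤) ∧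
        -- the gradient is bounded up to the first time at which it tends to infinity
        ∃ T₁ : ℝ, 0 < T₁ ∧ T₁ ≤ T ∧
          (∀ t ∈ Ico 0 T₁, ∃ C : ℝ, ∀ s ∈ Icc 0 t, ∀ x, ‖fderiv ℝ (v s) x‖ ≤ C) ∧
          Tendsto (gradSup v) (𝓝[<] T₁) (𝓝 ⊤) := by
  have : Nonempty (Fin n) := ⟨⟨0, hn⟩⟩
  have : Nontrivial (EuclideanSpace ℝ (Fin n)) := inferInstance
  obtain ⟨α₀, hα₀⟩ := exists_lt_of_ciInf_lt hdet
  obtain ⟨η, hη, hneg⟩ := exists_forall_det_neg hα₀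
  obtain ⟨C₀, hC₀⟩ := hv₀.bounded 0 (by norm_num)
  obtain ⟨C₁, hC₁⟩ := hv₀.bounded 1 (by norm_num)
  simp only [norm_iteratedFDeriv_zero] at hC₀
  simp only [norm_iteratedFDeriv_one] at hC₁
  have hC₀0 : 0 ≤ C₀ := (norm_nonneg _).trans (hC₀ 0)
  -- momenta for which the velocity is nearly the momentum
  obtain ⟨ρ, hρ, hQ⟩ : ∃ ρ > 0, ∀ q : EuclideanSpace ℝ (Fin n), ‖q‖ ≤ ρ →
      ‖fderiv ℝ (velocityOf c) q - ContinuousLinearMap.id ℝ _‖ ≤ η / 2 := by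
    have h1 := (continuous_fderiv_velocityOf (E := EuclideanSpace ℝ (Fin n)) c).tendsto 0
    rw [fderiv_velocityOf_zero] at h1
    obtain ⟨ρ, hρ, h⟩ := Metric.eventually_nhds_iff.1
      (h1.eventually (Metric.closedBall_mem_nhds _ (half_pos hη)))
    refine ⟨ρ / 2, half_pos hρ, fun q hq => ?_⟩
    have := h (y := q) (by rw [dist_zero_right]; linarith)
    rwa [dist_eq_norm] at this
  have hzero : ‖(0 : EuclideanSpace ℝ (Fin n))‖ < c := by simpa using hc
  have hlin : Tendsto (fun ε : ℝ => ε • v₀ α₀) (𝓝 0) (𝓝 0) := by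
    have : Continuous fun ε : ℝ => ε • v₀ α₀ := by fun_prop
    simpa using this.tendsto 0
  have hP : ∀ᶠ ε : ℝ in 𝓝 0,
      ‖fderiv ℝ (momentumOf c) (ε • v₀ α₀) - ContinuousLinearMap.id ℝ _‖ < η := by
    have h1 := (continuousAt_fderiv_momentumOf hc hzero).tendsto.comp hlin
    rw [fderiv_momentumOf_zero] at h1
    filter_upwards [h1.eventually (Metric.ball_mem_nhds _ hη)] with ε h
    rwa [← dist_eq_norm]
  have hsmall : ∀ᶠ ε : ℝ in 𝓝 0, ‖momentumOf c (ε • v₀ α₀)‖ ≤ ρ := by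
    have h1 := (contDiffAt_momentumOf (k := 1) hc hzero).continuousAt.tendsto.comp hlin
    have h0 : momentumOf c (0 : EuclideanSpace ℝ (Fin n)) = 0 := by simp [momentumOf]
    rw [h0] at h1
    filter_upwards [h1.eventually (Metric.closedBall_mem_nhds _ hρ)] with ε h
    rwa [← dist_zero_right]
  obtain ⟨δ, hδ, hδP⟩ := Metric.eventually_nhds_iff.1 (hP.and hsmall)
  -- The first bound puts the momentum at `α₀` where both `velocityOf` and `momentumOf` are nearly
  -- the identity. The second keeps all initial speeds at most `c / 2`, on a compact ball where
  -- `momentumOf` and its derivative are bounded; the `+ 1` covers `C₀ = 0`.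
  refine ⟨min (δ / 2) (c / (2 * (C₀ + 1))), by positivity, fun a l ha ε hε => ?_⟩
  obtain ⟨A, hA, hAa, hAd⟩ := ha.exists_isRegularScale
  have hε0 : 0 < ε := hε.1
  obtain ⟨hN, hmρ⟩ := hδP (y := ε) (by
    rw [dist_zero_right, Real.norm_of_nonneg hε0.le]
    linarith [hε.2.trans (min_le_left _ _)])
  have hw : ∀ x, ‖ε • v₀ x‖ ≤ c / 2 := by
    intro x
    rw [norm_smul, Real.norm_of_nonneg hε0.le]
    calc ε * ‖v₀ x‖ ≤ c / (2 * (C₀ + 1)) * (C₀ + 1) := by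
          gcongr
          · exact hε.2.trans (min_le_right _ _)
          · exact (hC₀ x).trans (by linarith)
      _ = c / 2 := by field_simp
  have hwc : ∀ x, ‖ε • v₀ x‖ < c := fun x => (hw x).trans_lt (half_lt_self hc)
  have hv₀c : ContDiff ℝ 1 v₀ := hv₀.contDiff.of_le (by norm_num)
  have hwd : ContDiff ℝ 1 fun x => ε • v₀ x := hv₀c.const_smul ε
  set m : EuclideanSpace ℝ (Fin n) → EuclideanSpace ℝ (Fin n) := fun x => momentumOf c (ε • v₀ x)
  have hm : ContDiff ℝ 1 m := contDiff_iff_contDiffAt.2 fun x =>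
    ContDiffAt.comp (g := momentumOf c) x (contDiffAt_momentumOf hc (hwc x)) hwd.contDiffAt
  have hmd : ∀ x, fderiv ℝ m x = (fderiv ℝ (momentumOf c) (ε • v₀ x)).comp (ε • fderiv ℝ v₀ x) :=
    fun x => (HasFDerivAt.comp (g := momentumOf c) x
      ((contDiffAt_momentumOf (k := 1) hc (hwc x)).differentiableAt one_ne_zero).hasFDerivAt
      ((hv₀c.differentiable one_ne_zero x).hasFDerivAt.const_smul ε)).fderiv
  have hball : ∀ y ∈ Metric.closedBall (0 : EuclideanSpace ℝ (Fin n)) (c / 2), ‖y‖ < c := fun y hy =>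
    (mem_closedBall_zero_iff.1 hy).trans_lt (half_lt_self hc)
  obtain ⟨R, hR⟩ := (isCompact_closedBall (0 : EuclideanSpace ℝ (Fin n))
    (c / 2)).exists_bound_of_continuousOn (f := momentumOf c) fun y hy =>
      (contDiffAt_momentumOf (k := 1) hc (hball y hy)).continuousAt.continuousWithinAt
  obtain ⟨M, hM⟩ := (isCompact_closedBall (0 : EuclideanSpace ℝ (Fin n))
    (c / 2)).exists_bound_of_continuousOn (f := fderiv ℝ (momentumOf c)) fun y hy =>
      (continuousAt_fderiv_momentumOf hc (hball y hy)).continuousWithinAt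
  have hM0 : 0 ≤ M := (norm_nonneg _).trans (hM 0 (Metric.mem_closedBall_self (half_pos hc).le))
  have hmL : ∀ x, ‖fderiv ℝ m x‖ ≤ M * (ε * C₁) := by
    intro x
    rw [hmd]
    refine (ContinuousLinearMap.opNorm_comp_le _ _).trans ?_
    rw [norm_smul, Real.norm_of_nonneg hε0.le]
    gcongr
    · exact hM _ (by simpa using hw x)
    · exact hC₁ x
  have hinit : (fun x => ε • v₀ x) = fun x => velocityOf c (m x) :=
    funext fun x => (velocityOf_momentumOf hc (hwc x)).symm
  rw [hinit]
  exact exists_blowup_of_singular hc ha hA hAa hAd hm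
    (fun x => hR _ (mem_closedBall_zero_iff.2 (hw x))) hmL
    (exists_singular_of_small hA hm (ha.tendsto_integral hA hAa) hε0 hη hneg hN hQ hmρ (hmd α₀))
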